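/- Let $\mathrm{ZFU}_{\mathrm R}$ be the first-order theory, in the language $\{\in,\mathscr A\}$ where $\mathscr A$ is a unary predicate for urelements (a \emph{set} is an object that is not a urelement), whose axioms are: urelements have no members, Extensionality for sets, Foundation, Pairing, Union, Powerset, Infinity, the Separation scheme and the Replacement scheme (the urelements need not form a set, and no choice axiom is included). An \emph{ordinal} is a transitive pure set well-ordered by $\in$, where a set $x$ is \emph{pure} if no urelement belongs to the transitive closure of $\{x\}$. Consider the following principles. - SVC (Small Violations of Choice): there is a set $S$ such that for every set $x$ there are an ordinal $\alpha$ and a surjection from $S\times\alpha$ onto $x$. - Plenitude$^+$: for every set $x$ there is a set of urelements equinumerous with $x$. - Reflection Principle (a scheme, with one instance for each formula $\varphi(x_1,\dots,x_n)$ of the language): for every set $x$ there is a transitive set $t$ with $x\subseteq t$ such that for all $x_1,\dots,x_n\in t$, $\varphi(x_1,\dots,x_n)\leftrightarrow\varphi^t(x_1,\dots,x_n)$, where $\varphi^t$ is $\varphi$ with all quantifiers restricted to $t$. **Theorem.** $\mathrm{ZFU}_{\mathrm R}$ + SVC + Plenitude$^+$ implies the Reflection Principle; that is, in every model of $\mathrm{ZFU}_{\mathrm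 R}$ in which SVC and Plenitude$^+$ hold, every instance of the Reflection Principle holds. -/

import Mathlib

namespace Urelement

open FirstOrder FirstOrder.Language

/-- The relation symbols of the language of urelement set theory: a binary symbol for
membership and a unary predicate for "is a urelement". -/
inductive URel : ℕ → Type
  | mem : URel 2
  | ur : URel 1

/-- The first-order language `{∈, 𝒜}` of urelement set theory (with equality). -/
def LU : Language := ⟨fun _ => Empty, URel⟩

section Basic

variable {M : Type*} [LU.Structure M]

/-- `x` is a member of `y`, in the sense of the structure `M`. -/
def Mem (x y : M) : Prop := Structure.RelMap (L := LU) URel.mem ![x, y]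

infix:50 " ∈ᵤ " => Mem

/-- `x` is a urelement. -/
def IsUr (x : M) : Prop := Structure.RelMap (L := LU) URel.ur ![x]

/-- `x` is a set, i.e. not a urelement. -/
def IsSet (x : M) : Prop := ¬ IsUr x

/-- `x ⊆ y` (every member of `x` is a member of `y`). -/
def Sub (x y : M) : Prop := ∀ z : M, z ∈ᵤ x → z ∈ᵤ y

/-- `t` is a transitive set. -/
def IsTransSet (t : M) : Prop := IsSet t ∧ ∀ y : M, y ∈ᵤ t → Sub y t

end Basic

/-- `M` is a model of `ZFU_R`: Zermelo-Fraenkel set theory with urelements, formulated with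
Replacement. In the two schemes, "definable" is definability by a formula of `LU` with arbitrary
parameters from `M`. -/
structure ZFUR (M : Type*) [LU.Structure M] : Prop where
  /-- Urelements have no members. -/
  urelements : ∀ a x : M, IsUr a → ¬ x ∈ᵤ a
  /-- Sets with the same members are equal. -/
  extensionality : ∀ x y : M, IsSet x → IsSet y → (∀ z, z ∈ᵤ x ↔ z ∈ᵤ y) → x = y
  /-- Every object with a member has an `∈`-minimal member. -/
  foundation : ∀ x : M, (∃ y, y ∈ᵤ x) → ∃ y, y ∈ᵤ x ∧ ∀ z, z ∈ᵤ y → ¬ z ∈ᵤ x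
  /-- The unordered pair of two objects is a set. -/
  pairing : ∀ x y : M, ∃ z, IsSet z ∧ ∀ v, v ∈ᵤ z ↔ v = x ∨ v = y
  /-- The union of a set is a set. -/
  union : ∀ x : M, ∃ y, IsSet y ∧ ∀ z, z ∈ᵤ y ↔ ∃ w, w ∈ᵤ x ∧ z ∈ᵤ w
  /-- The set of all subsets of a set exists. -/
  powerset : ∀ x : M, ∃ y, IsSet y ∧ ∀ z, z ∈ᵤ y ↔ IsSet z ∧ Sub z x
  /-- There is a set containing the empty set and closed under `x ↦ x ∪ {x}`. -/
  infinity : ∃ s : M, IsSet s ∧ (∃ e, e ∈ᵤ s ∧ IsSet e ∧ ∀ z, ¬ z ∈ᵤ e) ∧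
    ∀ x, x ∈ᵤ s → ∃ y, y ∈ᵤ s ∧ IsSet y ∧ ∀ z, z ∈ᵤ y ↔ z ∈ᵤ x ∨ z = x
  /-- Separation scheme. -/
  separation : ∀ C : Set M, (Set.univ : Set M).Definable₁ LU C →
    ∀ x : M, ∃ y, IsSet y ∧ ∀ z, z ∈ᵤ y ↔ z ∈ᵤ x ∧ z ∈ C
  /-- Replacement scheme. -/
  replacement : ∀ F : Set (M × M), (Set.univ : Set M).Definable₂ LU F →
    ∀ w : M, (∀ x, x ∈ᵤ w → ∃! y, (x, y) ∈ F) →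
      ∃ v, IsSet v ∧ ∀ x, x ∈ᵤ w → ∃ y, y ∈ᵤ v ∧ (x, y) ∈ F

section Notions

variable {M : Type*} [LU.Structure M]

/-- `z = {x, y}`. -/
def IsUPair (z x y : M) : Prop := IsSet z ∧ ∀ v : M, v ∈ᵤ z ↔ v = x ∨ v = y

/-- `z = ⟨x, y⟩ = {{x}, {x, y}}`. -/
def IsOPair (z x y : M) : Prop := ∃ a b : M, IsUPair a x x ∧ IsUPair b x y ∧ IsUPair z a b

/-- `⟨a, b⟩ ∈ f`. -/
def PairMem (a b f : M) : Prop := ∃ p : M, IsOPair p a b ∧ p ∈ᵤ f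

/-- `f` is (the graph of) a function from `x` to `y`. -/
def IsFun (f x y : M) : Prop :=
  IsSet f ∧ (∀ p, p ∈ᵤ f → ∃ a b, a ∈ᵤ x ∧ b ∈ᵤ y ∧ IsOPair p a b) ∧
    ∀ a, a ∈ᵤ x → ∃! b, PairMem a b f

/-- `f` is a surjection from `x` onto `y`. -/
def IsSurj (f x y : M) : Prop := IsFun f x y ∧ ∀ b, b ∈ᵤ y → ∃ a, PairMem a b f

/-- `f` is an injection from `x` into `y`. -/
def IsInj (f x y : M) : Prop :=
  IsFun f x y ∧ ∀ a a' b, PairMem a b f → PairMem a' b f → a = a'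

/-- `x ∼ y`: there is (in `M`) a bijection between `x` and `y`. -/
def Equinum (x y : M) : Prop := ∃ f : M, IsInj f x y ∧ IsSurj f x y

/-- `x ⪯* y`: there is (in `M`) a surjection from `y` onto `x`. -/
def SurjLE (x y : M) : Prop := ∃ f : M, IsSurj f y x

/-- `p = x × y`. -/
def IsProd (p x y : M) : Prop :=
  IsSet p ∧ ∀ z, z ∈ᵤ p ↔ ∃ a b, a ∈ᵤ x ∧ b ∈ᵤ y ∧ IsOPair z a b

/-- `y` belongs to the transitive closure of `{x}`, that is, to every transitive set that
contains `x`. -/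
def InTC (y x : M) : Prop := ∀ t : M, IsTransSet t → x ∈ᵤ t → y ∈ᵤ t

/-- `x` is a pure set: a set whose kernel (the set of urelements in the transitive closure of
`{x}`) is empty. -/
def IsPure (x : M) : Prop := IsSet x ∧ ∀ a : M, IsUr a → ¬ InTC a x

/-- `x` is well-ordered by the membership relation (strict linear order in which every nonempty
subset has a least element). -/
def WellOrderedByMem (x : M) : Prop :=
  (∀ a, a ∈ᵤ x → ¬ a ∈ᵤ a) ∧
  (∀ a b c, a ∈ᵤ x → b ∈ᵤ x → c ∈ᵤ x → a ∈ᵤ b → b ∈ᵤ c → a ∈ᵤ c) ∧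
  (∀ a b, a ∈ᵤ x → b ∈ᵤ x → a ∈ᵤ b ∨ a = b ∨ b ∈ᵤ a) ∧
  ∀ s : M, Sub s x → (∃ a, a ∈ᵤ s) → ∃ a, a ∈ᵤ s ∧ ∀ b, b ∈ᵤ s → a = b ∨ a ∈ᵤ b

/-- `α` is an ordinal of `M`: a transitive pure set well-ordered by membership. -/
def IsOrd (α : M) : Prop := IsTransSet α ∧ IsPure α ∧ WellOrderedByMem α

/-- `φ^t`: truth of `φ` with all quantifiers restricted to the members of `t`. -/
def RealizeIn (t : M) {β : Type*} :
    ∀ {n : ℕ}, LU.BoundedFormula β n → (β → M) → (Fin n → M) → Prop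
  | _, .falsum, _, _ => False
  | _, .equal t₁ t₂, v, xs =>
      t₁.realize (Sum.elim v xs) = t₂.realize (Sum.elim v xs)
  | _, .rel R ts, v, xs =>
      Structure.RelMap R fun i => (ts i).realize (Sum.elim v xs)
  | _, .imp φ ψ, v, xs => RealizeIn t φ v xs → RealizeIn t ψ v xs
  | _, .all φ, v, xs => ∀ y : M, y ∈ᵤ t → RealizeIn t φ v (Fin.snoc xs y)

end Notions

/-- Small Violations of Choice: there is a set `S` such that for every set `x` there is an
ordinal `α` with `x ⪯* S × α`. -/
def SVC (M : Type*) [LU.Structure M] : Prop :=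
  ∃ S : M, IsSet S ∧ ∀ x : M, IsSet x →
    ∃ α p : M, IsOrd α ∧ IsProd p S α ∧ SurjLE x p

/-- Plenitude⁺: every set is equinumerous with a set of urelements. -/
def PlenitudePlus (M : Type*) [LU.Structure M] : Prop :=
  ∀ x : M, IsSet x → ∃ A : M, IsSet A ∧ (∀ a, a ∈ᵤ A → IsUr a) ∧ Equinum x A

/-- The Reflection Principle for the formula `φ(x₁, …, xₙ)`: for every set `x` there is a
transitive set `t ⊇ x` such that `φ(x₁, …, xₙ) ↔ φ^t(x₁, …, xₙ)` for all `x₁, …, xₙ ∈ t`. -/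
def Reflects (M : Type*) [LU.Structure M] {n : ℕ} (φ : LU.Formula (Fin n)) : Prop :=
  ∀ x : M, IsSet x → ∃ t : M, IsTransSet t ∧ Sub x t ∧
    ∀ v : Fin n → M, (∀ i, v i ∈ᵤ t) → (φ.Realize v ↔ RealizeIn t φ v Fin.elim0)

/-- The Reflection Principle: the scheme of all its instances. -/
def ReflectionPrinciple (M : Type*) [LU.Structure M] : Prop :=
  ∀ (n : ℕ) (φ : LU.Formula (Fin n)), Reflects M φ

end Urelement

/-! The proof is a Tarski–Vaught argument. Replacement yields bounds only for definably chosen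
values such as least ordinals, whereas witnesses to an existential formula may involve arbitrary
urelements. Automorphisms of the model compensate: a definable injection between sets of urelements
extends to a definable automorphism fixing any given urelements off both sets
(`PlenitudePlus.exists_move`), and parameter-free formulas are invariant under it.

SVC gives a set `T` such that every set injects into `T × b` for some ordinal `b`
(`SVC.exists_injVia`). Let `K` be the set of urelements of a transitive set containing `x`.
Plenitude⁺ gives injections `h` from `T × (a × a)` into the urelements outside `K`; let `base` be
`K` together with the values of `h`, and consider the cumulative levels over `base`.

For tuples from level `a`, a witness lies in some level `b` over `base` and a set `L` of new
urelements injecting into `T × b`. Any two choices of `h` are conjugate over `K`, so `b` can be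
chosen from `a` alone, before `h` (`exists_bounds`). Take a limit `l` closed under these bounds,
then an `h` on `T × (l × l)`, and let `t` be the union of the levels `a` over `base K T h a` for `a`
in `l`. Given a witness with its set `L`, code an element of `L` by `(s, c)` in `T × b` and move it
to the value of `h` at `(s, (c, a))`. The tag `a` makes this value new over the base at `a`, so the
move can fix the parameters while bringing the witness into `t` (`Bounds.exists_mem`). -/

namespace Urelement

open FirstOrder FirstOrder.Language

set_option linter.unusedSectionVars false

/-! ### Definability with parameters, verified by instance search. -/

section Definability

variable {M : Type*} [LU.Structure M] {α β γ : Type}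

/-- `P` is definable with parameters in the structure `M`. -/
class Dfn (P : (α → M) → Prop) : Prop where
  out : (Set.univ : Set M).Definable LU {v | P v}

/-- `f` has a graph that is definable with parameters in the structure `M`. -/
class DF (f : (α → M) → M) : Prop where
  out : (Set.univ : Set M).DefinableFun LU f

/-- Restriction of an assignment to the left block of variables. -/
def pl (w : α ⊕ β → M) : α → M := fun a => w (Sum.inl a)

/-- Restriction of an assignment to the right block of variables. -/
def pr (w : α ⊕ β → M) : β → M := fun a => w (Sum.inr a)

/-- The last variable of an assignment extended by one variable. -/
def top (w : α ⊕ Unit → M) : M := w (Sum.inr ())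

/-- `g` is a substitution of variables for variables. -/
class VarSubst (g : (α → M) → (β → M)) : Prop where
  out : ∃ σ : β → α, ∀ w, g w = w ∘ σ

instance VarSubst.refl : VarSubst (fun w : α → M => w) := ⟨id, fun _ => rfl⟩

instance VarSubst.pl : VarSubst (pl : (α ⊕ β → M) → (α → M)) := ⟨Sum.inl, fun _ => rfl⟩

instance VarSubst.pr : VarSubst (pr : (α ⊕ β → M) → (β → M)) := ⟨Sum.inr, fun _ => rfl⟩

instance VarSubst.left (g : (γ → M) → (α ⊕ β → M)) [h : VarSubst g] :
    VarSubst (fun w => Urelement.pl (g w)) := by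
  obtain ⟨σ, hσ⟩ := h.out
  exact ⟨σ ∘ Sum.inl, fun w => by funext a; simp [Urelement.pl, hσ]⟩

theorem Dfn.congr {P Q : (α → M) → Prop} (hP : Dfn P) (h : ∀ v, Q v ↔ P v) : Dfn Q := by
  have : Q = P := funext fun v => propext (h v)
  rwa [this]

theorem DF.congr {f g : (α → M) → M} (hf : DF f) (h : ∀ v, g v = f v) : DF g := by
  have : g = f := funext h
  rwa [this]

theorem Dfn.subst {P : (β → M) → Prop} [Finite β] (hP : Dfn P) (f : β → (α → M) → M)
    (hf : ∀ i, DF (f i)) : Dfn (fun v => P (fun i => f i v)) :=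
  ⟨Set.Definable.preimage_map (F := fun v i => f i v) (fun i => (hf i).out) hP.out⟩

theorem DF.iff_graph {f : (α → M) → M} :
    DF f ↔ Dfn (fun w : α ⊕ Unit → M => top w = f (pl w)) := by
  constructor
  · intro h
    refine ⟨?_⟩
    have := h.out.preimage_comp
      (fun o : Option α => o.elim (Sum.inr () : α ⊕ Unit) Sum.inl)
    convert this using 1
    ext w
    simp [Function.tupleGraph, top, Function.comp_def, eq_comm]
    rfl
  · intro h
    refine ⟨?_⟩
    have := h.out.preimage_comp
      (Sum.elim some (fun _ => none) : α ⊕ Unit → Option α)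
    unfold Set.DefinableFun
    convert this using 1
    ext w
    simp [Function.tupleGraph, top, Function.comp_def, eq_comm]
    rfl

instance DF.comp_var (f : (β → M) → M) (g : (α → M) → (β → M)) [hf : DF f]
    [hg : VarSubst g] : DF (fun v => f (g v)) := by
  rw [DF.iff_graph]
  obtain ⟨σ, hσ⟩ := hg.out
  have := (DF.iff_graph.1 hf).out.preimage_comp
    (Sum.map σ id : β ⊕ Unit → α ⊕ Unit)
  refine Dfn.congr ⟨this⟩ fun v => ?_
  simp only [hσ]
  rfl

instance DF.const (c : M) : DF (fun _ : α → M => c) :=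
  ⟨LU.definableFun_const α (Set.mem_univ c)⟩

instance DF.var (i : β) (g : (α → M) → (β → M)) [hg : VarSubst g] : DF (fun v => g v i) := by
  obtain ⟨σ, hσ⟩ := hg.out
  exact DF.congr ⟨Set.DefinableFun.proj LU (i := σ i)⟩ (fun v => by simp [hσ])

instance DF.top (g : (α → M) → (β ⊕ Unit → M)) [hg : VarSubst g] :
    DF (fun v => top (g v)) := DF.var (Sum.inr ()) g

instance DF.top_self : DF (Urelement.top : (β ⊕ Unit → M) → M) := DF.top (fun w => w)

instance Dfn.eq (f g : (α → M) → M) [hf : DF f] [hg : DF g] : Dfn (fun v => f v = g v) :=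
  ⟨hf.out.ofPred_eq hg.out⟩

instance Dfn.and (P Q : (α → M) → Prop) [hP : Dfn P] [hQ : Dfn Q] :
    Dfn (fun v => P v ∧ Q v) := ⟨hP.out.inter hQ.out⟩

instance Dfn.or (P Q : (α → M) → Prop) [hP : Dfn P] [hQ : Dfn Q] :
    Dfn (fun v => P v ∨ Q v) := ⟨hP.out.union hQ.out⟩

instance Dfn.not (P : (α → M) → Prop) [hP : Dfn P] : Dfn (fun v => ¬ P v) := ⟨hP.out.compl⟩

instance Dfn.imp (P Q : (α → M) → Prop) [hP : Dfn P] [hQ : Dfn Q] :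
    Dfn (fun v => P v → Q v) :=
  Dfn.congr (inferInstanceAs (Dfn (fun v => ¬ P v ∨ Q v))) fun _ => imp_iff_not_or

instance Dfn.iff (P Q : (α → M) → Prop) [hP : Dfn P] [hQ : Dfn Q] :
    Dfn (fun v => P v ↔ Q v) :=
  Dfn.congr (inferInstanceAs (Dfn (fun v => (P v → Q v) ∧ (Q v → P v)))) fun _ => iff_iff_implies_and_implies

instance Dfn.const (p : Prop) : Dfn (fun _ : α → M => p) := by
  by_cases h : p
  · exact ⟨by simp [h]⟩
  · exact ⟨by simp [h]⟩

instance Dfn.forall_block [Finite β] (P : (α → M) → (β → M) → Prop)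
    [hP : Dfn (fun w : α ⊕ β → M => P (pl w) (pr w))] : Dfn (fun v => ∀ u : β → M, P v u) :=
  ⟨hP.out.forall_of_finite⟩

instance Dfn.exists (P : (α → M) → M → Prop)
    [hP : Dfn (fun w : α ⊕ Unit → M => P (pl w) (Urelement.top w))] :
    Dfn (fun v => ∃ x, P v x) :=
  Dfn.congr ⟨hP.out.exists_of_finite⟩ fun _ =>
    ⟨fun ⟨x, hx⟩ => ⟨fun _ => x, hx⟩, fun ⟨u, hu⟩ => ⟨u (), hu⟩⟩

instance Dfn.forall (P : (α → M) → M → Prop)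
    [hP : Dfn (fun w : α ⊕ Unit → M => P (pl w) (Urelement.top w))] :
    Dfn (fun v => ∀ x, P v x) :=
  Dfn.congr ⟨hP.out.forall_of_finite⟩ fun _ => ⟨fun h u => h (u ()), fun h x => h fun _ => x⟩

instance Dfn.forall_fin (k : ℕ) (P : (α → M) → Fin k → Prop) [hP : ∀ i, Dfn (fun v => P v i)] :
    Dfn (fun v => ∀ i, P v i) := by
  refine ⟨?_⟩
  convert Set.definable_iInter_of_finite (fun i => (hP i).out) using 1
  ext v
  simp

instance Dfn.mem (f g : (α → M) → M) [hf : DF f] [hg : DF g] : Dfn (fun v => f v ∈ᵤ g v) := by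
  have : Dfn (fun w : Fin 2 → M => w 0 ∈ᵤ w 1) := by
    refine ⟨Set.Definable.mono (A := ∅) (Set.empty_definable_iff.2 ?_) (Set.empty_subset _)⟩
    refine ⟨Relations.formula (L := LU) URel.mem ![Term.var 0, Term.var 1], ?_⟩
    ext w
    simp only [Mem, Set.mem_ofPred_eq]
    rw [iff_iff_eq]
    congr 1
    funext i
    fin_cases i <;> rfl
  exact this.subst ![f, g] (fun i => by fin_cases i <;> assumption)

instance Dfn.isUr (f : (α → M) → M) [hf : DF f] : Dfn (fun v => IsUr (f v)) := by
  have : Dfn (fun w : Fin 1 → M => IsUr (w 0)) := by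
    refine ⟨Set.Definable.mono (A := ∅) (Set.empty_definable_iff.2 ?_) (Set.empty_subset _)⟩
    refine ⟨Relations.formula (L := LU) URel.ur ![Term.var 0], ?_⟩
    ext w
    simp only [IsUr, Set.mem_ofPred_eq]
    rw [iff_iff_eq]
    congr 1
    funext i
    fin_cases i; rfl
  exact this.subst ![f] (fun i => by fin_cases i; assumption)

instance Dfn.isSet (f : (α → M) → M) [hf : DF f] : Dfn (fun v => IsSet (f v)) := by
  unfold IsSet; infer_instance

instance Dfn.sub (f g : (α → M) → M) [hf : DF f] [hg : DF g] : Dfn (fun v => Sub (f v) (g v)) := by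
  unfold Sub; infer_instance

instance Dfn.isTransSet (f : (α → M) → M) [hf : DF f] : Dfn (fun v => IsTransSet (f v)) := by
  unfold IsTransSet; infer_instance

/-- The unique element with the property `P`, if there is exactly one. -/
noncomputable def the [Nonempty M] (P : M → Prop) : M :=
  open Classical in if h : ∃! x, P x then h.choose else Classical.arbitrary M

theorem the_eq [Nonempty M] {P : M → Prop} {x : M} (hx : P x) (h : ∀ y, P y → y = x) :
    the P = x := by
  have hex : ∃! x, P x := ⟨x, hx, h⟩
  rw [the, dif_pos hex]
  exact h _ hex.choose_spec.1

instance DF.the [Nonempty M] (P : (α → M) → M → Prop)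
    [hP : Dfn (fun w : α ⊕ Unit → M => P (pl w) (Urelement.top w))] :
    DF (fun v => the (fun x => P v x)) := by
  rw [DF.iff_graph]
  -- The default value of `the` is a fixed element of `M`, hence a legitimate parameter.
  have h : Dfn (fun w : α ⊕ Unit → M =>
      (P (pl w) (Urelement.top w) ∧ ∀ y, P (pl w) y → y = Urelement.top w) ∨
      ((¬ ∃ x, P (pl w) x ∧ ∀ y, P (pl w) y → y = x) ∧
        Urelement.top w = Classical.arbitrary M)) := by
    have h1 : Dfn (fun w : (α ⊕ Unit) ⊕ Unit → M => P (pl (pl w)) (Urelement.top w)) := by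
      have := hP.out.preimage_comp (Sum.map Sum.inl id : α ⊕ Unit → (α ⊕ Unit) ⊕ Unit)
      exact Dfn.congr ⟨this⟩ fun _ => Iff.rfl
    have h2 : Dfn (fun w : ((α ⊕ Unit) ⊕ Unit) ⊕ Unit → M =>
        P (pl (pl (pl w))) (Urelement.top w)) := by
      have := hP.out.preimage_comp (Sum.map (Sum.inl ∘ Sum.inl) id :
        α ⊕ Unit → ((α ⊕ Unit) ⊕ Unit) ⊕ Unit)
      exact Dfn.congr ⟨this⟩ fun _ => Iff.rfl
    infer_instance
  refine h.congr fun w => ?_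
  rw [Urelement.the]
  by_cases hex : ∃! x, P (pl w) x
  · obtain ⟨x, hx, hu⟩ := id hex
    rw [dif_pos hex]
    have hc : hex.choose = x := hu _ hex.choose_spec.1
    rw [hc]
    constructor
    · intro e; rw [e]; exact Or.inl ⟨hx, hu⟩
    · rintro (⟨h1, h2⟩ | ⟨h1, -⟩)
      · exact hu _ h1
      · exact absurd ⟨x, hx, hu⟩ h1
  · rw [dif_neg hex]
    constructor
    · intro e; exact Or.inr ⟨hex, e⟩
    · rintro (h1 | ⟨-, h1⟩)
      · exact absurd ⟨_, h1⟩ hex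
      · exact h1

/-- Moves definability from a single variable to any context. Partially applied versions of this and
its analogues serve as local instances in later proofs. -/
theorem Dfn.app₁ {P : M → Prop} (h : Dfn (fun v : Unit → M => P (v ()))) (f : (α → M) → M)
    [hf : DF f] : Dfn (fun v => P (f v)) :=
  h.subst (fun _ => f) (fun _ => hf)

theorem DF.app₁ {F : M → M} (h : DF (fun v : Unit → M => F (v ()))) (f : (α → M) → M)
    [hf : DF f] : DF (fun v => F (f v)) := by
  rw [DF.iff_graph] at h ⊢
  exact h.subst (Sum.elim (fun _ w => f (pl w)) (fun _ w => Urelement.top w))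
    (by rintro (_ | _) <;> simp only [Sum.elim_inl, Sum.elim_inr] <;> infer_instance)

theorem Dfn.app₂ {P : M → M → Prop} (h : Dfn (fun v : Bool → M => P (v false) (v true)))
    (f g : (α → M) → M) [hf : DF f] [hg : DF g] : Dfn (fun v => P (f v) (g v)) :=
  h.subst (fun b => if b then g else f) (by rintro (_ | _) <;> simpa)

theorem DF.app₂ {F : M → M → M} (h : DF (fun v : Bool → M => F (v false) (v true)))
    (f g : (α → M) → M) [hf : DF f] [hg : DF g] : DF (fun v => F (f v) (g v)) := by
  rw [DF.iff_graph] at h ⊢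
  have := h.subst (Sum.elim (fun b w => if b then g (pl w) else f (pl w))
    (fun _ w => Urelement.top w) : Bool ⊕ Unit → (α ⊕ Unit → M) → M)
    (by rintro ((_ | _) | _) <;> simp <;> infer_instance)
  exact this.congr fun _ => Iff.rfl

end Definability

/-- The class of models of `ZFU_R`. -/
class ZFUModel (M : Type*) [LU.Structure M] : Prop where
  out : ZFUR M

/-! ### Set-theoretic operations inside a model. -/

section Basics

variable {M : Type*} [LU.Structure M] {α β γ : Type}

theorem Dfn.rename {Q : (β → M) → Prop} (h : Dfn Q) (σ : β → α) : Dfn (fun w => Q (w ∘ σ)) :=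
  ⟨h.out.preimage_comp σ⟩

theorem DF.rename {f : (β → M) → M} (h : DF f) (σ : β → α) : DF (fun w => f (w ∘ σ)) := by
  have : VarSubst (fun w : α → M => w ∘ σ) := ⟨σ, fun _ => rfl⟩
  exact DF.comp_var f _

variable [ZFUModel M]

instance ZFUModel.nonempty : Nonempty M := ⟨(ZFUModel.out (M := M)).infinity.choose⟩

theorem isSet_of_mem {x y : M} (h : x ∈ᵤ y) : IsSet y :=
  fun hy => ZFUModel.out.urelements _ _ hy h

theorem set_ext {x y : M} (hx : IsSet x) (hy : IsSet y) (h : ∀ z, z ∈ᵤ x ↔ z ∈ᵤ y) : x = y :=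
  ZFUModel.out.extensionality x y hx hy h

/-- The class `C` is (the extension of) a set. -/
def Small (C : M → Prop) : Prop := ∃ y, IsSet y ∧ ∀ z, z ∈ᵤ y ↔ C z

/-- The set of all `z` with `C z`. -/
noncomputable def setMk (C : M → Prop) : M := the (fun y => IsSet y ∧ ∀ z, z ∈ᵤ y ↔ C z)

theorem Small.setMk_eq {C : M → Prop} {y : M} (hy : IsSet y) (h : ∀ z, z ∈ᵤ y ↔ C z) : setMk C = y :=
  the_eq ⟨hy, h⟩ fun _ hx => set_ext hx.1 hy fun z => (hx.2 z).trans (h z).symm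

theorem Small.mem_setMk {C : M → Prop} (h : Small C) {z : M} : z ∈ᵤ setMk C ↔ C z := by
  obtain ⟨y, hy, hC⟩ := h
  rw [Small.setMk_eq hy hC, hC]

theorem Small.isSet_setMk {C : M → Prop} (h : Small C) : IsSet (setMk C) := by
  obtain ⟨y, hy, hC⟩ := h
  rwa [Small.setMk_eq hy hC]

instance DF.collect (P : (α → M) → M → Prop)
    [hP : Dfn (fun w : α ⊕ Unit → M => P (pl w) (Urelement.top w))] :
    DF (fun v => setMk (fun z => P v z)) := by
  unfold setMk
  have h1 : Dfn (fun w : (α ⊕ Unit) ⊕ Unit → M => P (pl (pl w)) (Urelement.top w)) :=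
    hP.rename (Sum.map Sum.inl id)
  infer_instance

theorem small_sep {C : M → Prop} [hC : Dfn (fun v : Unit → M => C (v ()))] (x : M)
    (h : ∀ z, C z → z ∈ᵤ x) : Small C := by
  obtain ⟨y, hy, hz⟩ := ZFUModel.out.separation {z | C z} (Dfn.app₁ hC fun v : Fin 1 → M => v 0).out x
  exact ⟨y, hy, fun z => (hz z).trans ⟨fun h => h.2, fun hc => ⟨h z hc, hc⟩⟩⟩

/-- The empty set. -/
noncomputable def empty : M := setMk (fun _ => False)

/-- Separation needs some bounding object; which one is irrelevant, so `empty` may be used before it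
is known to be a set. -/
theorem small_false : Small (fun _ : M => False) := small_sep empty (fun _ h => h.elim)

@[simp] theorem not_mem_empty {z : M} : ¬ z ∈ᵤ empty := small_false.mem_setMk.not.2 id

theorem isSet_empty : IsSet (empty : M) := small_false.isSet_setMk

/-- The set of elements of `x` with the property `C`. -/
noncomputable def sep (x : M) (C : M → Prop) : M := setMk (fun z => z ∈ᵤ x ∧ C z)

section
variable {C : M → Prop} [hC : Dfn (fun v : Unit → M => C (v ()))]

theorem small_mem_and (x : M) : Small (fun z => z ∈ᵤ x ∧ C z) :=
  small_sep x (fun _ h => h.1)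

@[simp] theorem mem_sep {x z : M} : z ∈ᵤ sep x C ↔ z ∈ᵤ x ∧ C z := (small_mem_and x).mem_setMk

theorem isSet_sep {x : M} : IsSet (sep x C) := (small_mem_and x).isSet_setMk
end

instance DF.sep (f : (α → M) → M) [hf : DF f] (P : (α → M) → M → Prop)
    [hP : Dfn (fun w : α ⊕ Unit → M => P (pl w) (Urelement.top w))] :
    DF (fun v => sep (f v) (fun z => P v z)) := by
  unfold Urelement.sep; infer_instance

/-- The unordered pair. -/
noncomputable def upair (x y : M) : M := setMk (fun v => v = x ∨ v = y)

theorem small_upair (x y : M) : Small (fun v => v = x ∨ v = y) := ZFUModel.out.pairing x y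

@[simp] theorem mem_upair {x y z : M} : z ∈ᵤ upair x y ↔ z = x ∨ z = y := (small_upair x y).mem_setMk

theorem isSet_upair {x y : M} : IsSet (upair x y) := (small_upair x y).isSet_setMk

instance DF.upair (f g : (α → M) → M) [DF f] [DF g] : DF (fun v => upair (f v) (g v)) := by
  unfold Urelement.upair; infer_instance

/-- The ordered pair. -/
noncomputable def opair (x y : M) : M := upair (upair x x) (upair x y)

instance DF.opair (f g : (α → M) → M) [DF f] [DF g] : DF (fun v => opair (f v) (g v)) := by
  unfold Urelement.opair; infer_instance

theorem isUPair_iff {z x y : M} : IsUPair z x y ↔ z = upair x y :=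
  ⟨fun h => (Small.setMk_eq h.1 h.2).symm, fun h => h ▸ ⟨isSet_upair, fun _ => mem_upair⟩⟩

theorem isOPair_iff {z x y : M} : IsOPair z x y ↔ z = opair x y := by
  simp [IsOPair, isUPair_iff, opair]

theorem pairMem_iff {a b f : M} : PairMem a b f ↔ opair a b ∈ᵤ f := by
  simp [PairMem, isOPair_iff]

theorem upair_inj_right {x y z : M} (h : upair x y = upair x z) : y = z := by
  have h1 : y ∈ᵤ upair x z := h ▸ mem_upair.2 (Or.inr rfl)
  have h2 : z ∈ᵤ upair x y := h ▸ mem_upair.2 (Or.inr rfl)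
  rw [mem_upair] at h1 h2
  rcases h1 with h1 | h1
  · rcases h2 with h2 | h2
    · rw [h1, h2]
    · exact h2.symm
  · exact h1

@[simp] theorem opair_inj {x y x' y' : M} : opair x y = opair x' y' ↔ x = x' ∧ y = y' := by
  refine ⟨fun h => ?_, fun h => by rw [h.1, h.2]⟩
  have hx : x = x' := by
    have h1 : upair x x ∈ᵤ opair x' y' := h ▸ mem_upair.2 (Or.inl rfl)
    rcases mem_upair.1 h1 with h1 | h1
    · have : x ∈ᵤ upair x' x' := h1 ▸ mem_upair.2 (Or.inl rfl)
      simpa using this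
    · have : x' ∈ᵤ upair x x := h1 ▸ mem_upair.2 (Or.inl rfl)
      simpa using Eq.symm (by simpa using this)
  subst hx
  exact ⟨rfl, upair_inj_right (upair_inj_right h)⟩

/-- The union of a set. -/
noncomputable def sUnion (x : M) : M := setMk (fun z => ∃ w, w ∈ᵤ x ∧ z ∈ᵤ w)

theorem small_sUnion (x : M) : Small (fun z => ∃ w, w ∈ᵤ x ∧ z ∈ᵤ w) := ZFUModel.out.union x

@[simp] theorem mem_sUnion {x z : M} : z ∈ᵤ sUnion x ↔ ∃ w, w ∈ᵤ x ∧ z ∈ᵤ w :=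
  (small_sUnion x).mem_setMk

theorem isSet_sUnion {x : M} : IsSet (sUnion x) := (small_sUnion x).isSet_setMk

instance DF.sUnion (f : (α → M) → M) [DF f] : DF (fun v => sUnion (f v)) := by
  unfold Urelement.sUnion; infer_instance

/-- The set of all subsets. -/
noncomputable def pow (x : M) : M := setMk (fun z => IsSet z ∧ Sub z x)

theorem small_pow (x : M) : Small (fun z => IsSet z ∧ Sub z x) := ZFUModel.out.powerset x

@[simp] theorem mem_pow {x z : M} : z ∈ᵤ pow x ↔ IsSet z ∧ Sub z x := (small_pow x).mem_setMk

instance DF.pow (f : (α → M) → M) [DF f] : DF (fun v => pow (f v)) := by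
  unfold Urelement.pow; infer_instance

/-- The union of two sets. -/
noncomputable def union (x y : M) : M := sUnion (upair x y)

@[simp] theorem mem_union {x y z : M} : z ∈ᵤ union x y ↔ z ∈ᵤ x ∨ z ∈ᵤ y := by
  simp [union]

theorem isSet_union {x y : M} : IsSet (union x y) := isSet_sUnion

instance DF.union (f g : (α → M) → M) [DF f] [DF g] : DF (fun v => union (f v) (g v)) := by
  unfold Urelement.union; infer_instance

/-- The set `x ∪ {x}`. -/
noncomputable def succ (x : M) : M := union x (upair x x)

@[simp] theorem mem_succ {x z : M} : z ∈ᵤ succ x ↔ z ∈ᵤ x ∨ z = x := by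
  simp [succ]

theorem isSet_succ {x : M} : IsSet (succ x) := isSet_union

instance DF.succ (f : (α → M) → M) [DF f] : DF (fun v => succ (f v)) := by
  unfold Urelement.succ; infer_instance

/-- The image of the set `x` under `F`. -/
noncomputable def img (F : M → M) (x : M) : M := setMk (fun y => ∃ z, z ∈ᵤ x ∧ y = F z)

section
variable {F : M → M} [hF : DF (fun v : Unit → M => F (v ()))]

theorem small_img (x : M) : Small (fun y => ∃ z, z ∈ᵤ x ∧ y = F z) := by
  have hF' := fun {α : Type} (f : (α → M) → M) [DF f] => DF.app₁ hF f
  have hd : Dfn (fun v : Fin 2 → M => v 1 = F (v 0)) := inferInstance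
  -- Replacement only gives a set covering the values; Separation then cuts it down.
  obtain ⟨v, -, hv⟩ := ZFUModel.out.replacement {p | p.2 = F p.1} hd.out x
    (fun x _ => ⟨F x, rfl, fun _ h => h⟩)
  refine small_sep v ?_
  rintro _ ⟨z, hz, rfl⟩
  obtain ⟨y, hy, h⟩ := hv z hz
  exact (show y = F z from h) ▸ hy

@[simp] theorem mem_img {x y : M} : y ∈ᵤ img F x ↔ ∃ z, z ∈ᵤ x ∧ y = F z := (small_img x).mem_setMk

theorem isSet_img {x : M} : IsSet (img F x) := (small_img x).isSet_setMk
end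

instance DF.img (F : (α → M) → M → M) (f : (α → M) → M) [DF f]
    [hF : DF (fun w : α ⊕ Unit → M => F (pl w) (Urelement.top w))] :
    DF (fun v => img (fun z => F v z) (f v)) := by
  unfold Urelement.img
  have h1 : DF (fun w : (α ⊕ Unit) ⊕ Unit → M => F (pl (pl w)) (Urelement.top w)) :=
    hF.rename (Sum.map Sum.inl id)
  infer_instance

theorem img_congr {F G : M → M} {x : M} (h : ∀ z, z ∈ᵤ x → F z = G z) : img F x = img G x := by
  unfold img
  congr 1
  funext y
  refine propext (exists_congr fun z => and_congr_right fun hz => ?_)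
  rw [h z hz]

/-- The cartesian product. -/
noncomputable def prod (x y : M) : M := sUnion (img (fun a => img (fun b => opair a b) y) x)

@[simp] theorem mem_prod {x y p : M} :
    p ∈ᵤ prod x y ↔ ∃ a b, a ∈ᵤ x ∧ b ∈ᵤ y ∧ p = opair a b := by
  simp only [prod, mem_sUnion, mem_img]
  constructor
  · rintro ⟨_, ⟨a, ha, rfl⟩, h⟩
    obtain ⟨b, hb, rfl⟩ := mem_img.1 h
    exact ⟨a, b, ha, hb, rfl⟩
  · rintro ⟨a, b, ha, hb, rfl⟩
    exact ⟨_, ⟨a, ha, rfl⟩, mem_img.2 ⟨b, hb, rfl⟩⟩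

theorem opair_mem_prod {x y a b : M} : opair a b ∈ᵤ prod x y ↔ a ∈ᵤ x ∧ b ∈ᵤ y := by
  simp only [mem_prod, opair_inj]
  constructor
  · rintro ⟨a', b', ha, hb, rfl, rfl⟩; exact ⟨ha, hb⟩
  · rintro ⟨ha, hb⟩; exact ⟨a, b, ha, hb, rfl, rfl⟩

theorem isSet_prod {x y : M} : IsSet (prod x y) := isSet_sUnion

instance DF.prod (f g : (α → M) → M) [DF f] [DF g] : DF (fun v => prod (f v) (g v)) := by
  unfold Urelement.prod; infer_instance

theorem isProd_iff {p x y : M} : IsProd p x y ↔ p = prod x y := by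
  constructor
  · rintro ⟨h1, h2⟩
    refine set_ext h1 isSet_prod fun z => ?_
    simp [h2, isOPair_iff]
  · rintro rfl
    exact ⟨isSet_prod, fun z => by simp [isOPair_iff]⟩

/-- The value of the internal function `f` at `a`. -/
noncomputable def app (f a : M) : M := the (fun b => opair a b ∈ᵤ f)

instance DF.app (f g : (α → M) → M) [DF f] [DF g] : DF (fun v => app (f v) (g v)) := by
  unfold Urelement.app; infer_instance

/-- The internal function with domain `x` and values given by `F`. -/
noncomputable def graph (F : M → M) (x : M) : M := img (fun u => opair u (F u)) x

section
variable {F : M → M} [hF : DF (fun v : Unit → M => F (v ()))]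

theorem app_graph {x u : M} (hu : u ∈ᵤ x) : app (graph F x) u = F u := by
  have hF' := fun {α : Type} (f : (α → M) → M) [DF f] => DF.app₁ hF f
  refine the_eq (mem_img.2 ⟨u, hu, rfl⟩) ?_
  intro y hy
  obtain ⟨z, -, h⟩ := mem_img.1 hy
  rw [opair_inj] at h
  rw [h.2, h.1]
end

theorem IsFun.app_eq {f x y a b : M} (hf : IsFun f x y) (ha : a ∈ᵤ x) (h : PairMem a b f) :
    app f a = b := by
  obtain ⟨c, -, hu⟩ := hf.2.2 a ha
  refine the_eq (pairMem_iff.1 h) fun y hy => ?_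
  rw [hu y (pairMem_iff.2 hy), hu b h]

theorem IsFun.pairMem {f x y a : M} (hf : IsFun f x y) (ha : a ∈ᵤ x) :
    PairMem a (app f a) f := by
  obtain ⟨c, hc, -⟩ := hf.2.2 a ha
  rwa [hf.app_eq ha hc]

theorem IsFun.mem_of_pairMem {f x y a b : M} (hf : IsFun f x y) (h : PairMem a b f) :
    a ∈ᵤ x ∧ b ∈ᵤ y := by
  rw [pairMem_iff] at h
  obtain ⟨a', b', ha, hb, he⟩ := hf.2.1 _ h
  rw [isOPair_iff, opair_inj] at he
  exact ⟨he.1 ▸ ha, he.2 ▸ hb⟩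

theorem IsFun.app_mem {f x y a : M} (hf : IsFun f x y) (ha : a ∈ᵤ x) : app f a ∈ᵤ y :=
  (hf.mem_of_pairMem (hf.pairMem ha)).2

/-- Every nonempty definable subclass of a set has an `∈`-minimal element. -/
theorem exists_minimal (P : M → Prop) [hP : Dfn (fun v : Unit → M => P (v ()))] {t x : M}
    (hx : x ∈ᵤ t) (h : P x) :
    ∃ y, y ∈ᵤ t ∧ P y ∧ ∀ z, z ∈ᵤ y → z ∈ᵤ t → ¬ P z := by
  obtain ⟨y, hy, hm⟩ := ZFUModel.out.foundation (sep t P) ⟨x, mem_sep.2 ⟨hx, h⟩⟩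
  rw [mem_sep] at hy
  exact ⟨y, hy.1, hy.2, fun z hz hzt hp => hm z hz (mem_sep.2 ⟨hzt, hp⟩)⟩

theorem not_mem_self (x : M) : ¬ x ∈ᵤ x := by
  obtain ⟨y, hy, hm⟩ := ZFUModel.out.foundation (upair x x) ⟨x, mem_upair.2 (Or.inl rfl)⟩
  intro h
  simp only [mem_upair, or_self] at hy hm
  exact hm x (hy ▸ h) rfl

end Basics

/-! ### Recursion on membership, ordinals, and bounding by ordinals. -/

section Recursion

variable {M : Type*} [LU.Structure M] {α β γ : Type}

theorem DF.app₂_ctx {G : (α → M) → M → M → M}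
    (hG : DF (fun w : (α ⊕ Unit) ⊕ Unit → M => G (pl (pl w)) (Urelement.top (pl w)) (Urelement.top w)))
    (g : (β → M) → (α → M)) [hg : VarSubst g] (a b : (β → M) → M) [DF a] [DF b] :
    DF (fun w => G (g w) (a w) (b w)) := by
  obtain ⟨σ, hσ⟩ := hg.out
  have h1 : DF (fun w : ((β ⊕ Unit) ⊕ Unit) ⊕ Unit → M =>
      G (g (pl (pl (pl w)))) (Urelement.top (pl w)) (Urelement.top w)) := by
    refine (hG.rename (Sum.map (Sum.map (Sum.inl ∘ σ) id) id)).congr fun w => ?_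
    rw [hσ]
    rfl
  rw [DF.iff_graph]
  have h2 : Dfn (fun w : β ⊕ Unit → M => ∃ x y, x = a (pl w) ∧ y = b (pl w) ∧
    Urelement.top w = G (g (pl w)) x y) := inferInstance
  refine h2.congr fun w => ?_
  simp

variable [ZFUModel M]

/-- On the transitive set `t`, the internal function `f` satisfies the recursion given by `G`. -/
def Approx (G : M → M → M) (t f : M) : Prop :=
  IsTransSet t ∧ ∀ z, z ∈ᵤ t → app f z = G z (img (fun u => app f u) z)

/-- The class function defined by `∈`-recursion: `recF G x = G x {recF G y | y ∈ x}`. -/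
noncomputable def recF (G : M → M → M) (x : M) : M :=
  the (fun y => ∃ t f, Approx G t f ∧ x ∈ᵤ t ∧ y = app f x)

instance DF.recF (G : (α → M) → M → M → M) (h : (α → M) → M) [DF h]
    [hG : DF (fun w : (α ⊕ Unit) ⊕ Unit → M =>
      G (pl (pl w)) (Urelement.top (pl w)) (Urelement.top w))] :
    DF (fun v => recF (fun a b => G v a b) (h v)) := by
  unfold Urelement.recF Approx
  have := fun {β : Type} (g : (β → M) → (α → M)) [VarSubst g] (a b : (β → M) → M) [DF a] [DF b] =>
    DF.app₂_ctx hG g a b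
  infer_instance

section
variable {G : M → M → M} [hG : DF (fun v : Bool → M => G (v false) (v true))]

theorem Approx.unique {t f t' f' z : M} (h : Approx G t f) (h' : Approx G t' f') (hz : z ∈ᵤ t)
    (hz' : z ∈ᵤ t') : app f z = app f' z := by
  by_contra hne
  obtain ⟨y, hy, ⟨hy', hn⟩, hmin⟩ :=
    exists_minimal (fun z => z ∈ᵤ t' ∧ ¬ app f z = app f' z) hz ⟨hz', hne⟩
  refine hn ?_
  rw [h.2 y hy, h'.2 y hy']
  congr 1
  refine img_congr fun u hu => ?_
  by_contra hne
  exact hmin u hu (h.1.2 y hy u hu) ⟨h'.1.2 y hy' u hu, hne⟩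

theorem Approx.recF_eq {t f z : M} (h : Approx G t f) (hz : z ∈ᵤ t) : recF G z = app f z :=
  the_eq ⟨t, f, h, hz, rfl⟩ fun _ ⟨_, _, h', hz', hy⟩ => hy.trans (h'.unique h hz' hz)

/-- At an `∈`-minimal point without an approximation, the values on its members are already
determined, and one more application of `G` produces an approximation there. -/
theorem exists_approx {t x : M} (ht : IsTransSet t) (hx : x ∈ᵤ t) :
    ∃ t f, Approx G t f ∧ x ∈ᵤ t := by
  have hG' := fun {α : Type} (f g : (α → M) → M) [DF f] [DF g] => DF.app₂ hG f g
  by_contra hne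
  set A : M → Prop := fun z => ∃ t f, Approx G t f ∧ z ∈ᵤ t with hA
  have hAd {α : Type} (f : (α → M) → M) [DF f] : Dfn (fun v => A (f v)) := by
    simp only [hA, Approx]
    infer_instance
  obtain ⟨z, hz, hnz, hmin⟩ := exists_minimal (fun z => ¬ A z) hx hne
  have hmem : ∀ u, u ∈ᵤ z → A u := fun u hu => not_not.1 (hmin u hu (ht.2 z hz u hu))
  have hdown : ∀ u v, A u → v ∈ᵤ u → A v := fun u v ⟨t, f, h, hu⟩ hv =>
    ⟨t, f, h, h.1.2 u hu v hv⟩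
  -- `recF G` where approximations exist, one step of `G` beyond.
  let R : M → M := fun u =>
    the (fun y => (A u ∧ y = recF G u) ∨ (¬ A u ∧ y = G u (img (fun w => recF G w) u)))
  have hR1 : ∀ u, A u → R u = recF G u := fun u hu =>
    the_eq (Or.inl ⟨hu, rfl⟩) fun y hy => by simpa [hu] using hy
  have hR2 : ∀ u, ¬ A u → R u = G u (img (fun w => recF G w) u) := fun u hu =>
    the_eq (Or.inr ⟨hu, rfl⟩) fun y hy => by simpa [hu] using hy
  have hRd : DF (fun v : Unit → M => R (v ())) := by
    simp only [R]
    infer_instance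
  have hRG : ∀ u, (∀ v, v ∈ᵤ u → A v) → R u = G u (img R u) := by
    intro u hu
    have e : img R u = img (fun w => recF G w) u := img_congr fun v hv => hR1 v (hu v hv)
    by_cases hAu : A u
    · obtain ⟨t', f, h, hut⟩ := id hAu
      rw [hR1 u hAu, h.recF_eq hut, h.2 u hut, e]
      congr 1
      exact img_congr fun v hv => (h.recF_eq (h.1.2 u hut v hv)).symm
    · rw [hR2 u hAu, e]
  let s := sep t (fun u => A u ∨ u = z)
  have hs : ∀ u, u ∈ᵤ s → ∀ v, v ∈ᵤ u → A v := by
    intro u hu v hv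
    rcases (mem_sep.1 hu).2 with h | rfl
    · exact hdown u v h hv
    · exact hmem v hv
  have hst : IsTransSet s := ⟨isSet_sep, fun u hu v hv =>
    mem_sep.2 ⟨ht.2 u (mem_sep.1 hu).1 v hv, Or.inl (hs u hu v hv)⟩⟩
  refine hnz ⟨s, graph R s, ⟨hst, fun u hu => ?_⟩, mem_sep.2 ⟨hz, Or.inr rfl⟩⟩
  rw [app_graph hu, hRG u (hs u hu)]
  congr 1
  exact img_congr fun v hv => (app_graph (hst.2 u hu v hv)).symm

/-- The transitive set is a hypothesis because transitive closures are themselves built by recursion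
along a limit ordinal; `recF_eq` removes it afterwards. -/
theorem recF_eq_of_mem {t x : M} (ht : IsTransSet t) (hx : x ∈ᵤ t) :
    recF G x = G x (img (fun u => recF G u) x) := by
  obtain ⟨t, f, h, hx⟩ := exists_approx (G := G) ht hx
  rw [h.recF_eq hx, h.2 x hx]
  congr 1
  exact img_congr fun v hv => (h.recF_eq (h.1.2 x hx v hv)).symm
end

/-- Transitive sets of transitive sets; by Foundation, these are the ordinals. -/
def Ord (x : M) : Prop := IsTransSet x ∧ ∀ y, y ∈ᵤ x → IsTransSet y

instance Dfn.ord (f : (α → M) → M) [DF f] : Dfn (fun v => Ord (f v)) := by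
  unfold Ord; infer_instance

/-- Purity excludes urelements as members, and transitivity of `∈` on `x` makes the members
transitive. -/
theorem IsOrd.ord {x : M} (h : IsOrd x) : Ord x := by
  obtain ⟨ht, hp, -, htr, -, -⟩ := h
  refine ⟨ht, fun y hy => ⟨fun hu => hp.2 y hu fun t htt hxt => htt.2 x hxt y hy, ?_⟩⟩
  intro z hz w hw
  have hzx := ht.2 y hy z hz
  exact htr w z y (ht.2 z hzx w hw) hzx hy hw hz

theorem Ord.of_mem {x y : M} (h : Ord x) (hy : y ∈ᵤ x) : Ord y :=
  ⟨h.2 y hy, fun z hz => h.2 z (h.1.2 y hy z hz)⟩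

theorem Ord.sub_of_mem {x y : M} (h : Ord x) (hy : y ∈ᵤ x) : Sub y x := h.1.2 y hy

theorem ord_empty : Ord (empty : M) :=
  ⟨⟨isSet_empty, fun _ h => (not_mem_empty h).elim⟩, fun _ h => (not_mem_empty h).elim⟩

theorem Ord.succ {x : M} (h : Ord x) : Ord (succ x) := by
  refine ⟨⟨isSet_succ, fun y hy z hz => ?_⟩, fun y hy => ?_⟩
  · rw [mem_succ] at hy ⊢
    rcases hy with hy | rfl
    · exact Or.inl (h.1.2 y hy z hz)
    · exact Or.inl hz
  · rcases mem_succ.1 hy with hy | rfl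
    · exact h.2 y hy
    · exact h.1

theorem ord_sUnion {x : M} (h : ∀ y, y ∈ᵤ x → Ord y) : Ord (sUnion x) := by
  refine ⟨⟨isSet_sUnion, fun y hy z hz => ?_⟩, fun y hy => ?_⟩
  · obtain ⟨w, hw, hyw⟩ := mem_sUnion.1 hy
    exact mem_sUnion.2 ⟨w, hw, (h w hw).1.2 y hyw z hz⟩
  · obtain ⟨w, hw, hyw⟩ := mem_sUnion.1 hy
    exact (h w hw).2 y hyw

theorem Ord.union {x y : M} (hx : Ord x) (hy : Ord y) : Ord (union x y) :=
  ord_sUnion fun z hz => by rcases mem_upair.1 hz with rfl | rfl <;> assumption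

/-- A limit ordinal. -/
def IsLimit (x : M) : Prop := Ord x ∧ empty ∈ᵤ x ∧ ∀ n, n ∈ᵤ x → succ n ∈ᵤ x

theorem exists_isLimit : ∃ x : M, IsLimit x := by
  obtain ⟨s, -, ⟨e, hes, he, hee⟩, hs⟩ := (ZFUModel.out (M := M)).infinity
  have hs' : ∀ x, x ∈ᵤ s → succ x ∈ᵤ s := by
    intro x hx
    obtain ⟨y, hy, hys, h⟩ := hs x hx
    rwa [show succ x = y from set_ext isSet_succ hys fun z => by simp [h] ]
  have he' : (empty : M) = e := set_ext isSet_empty he fun z => by simp [hee]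
  -- The set `s` need not be transitive; keeping only `n ⊆ s` makes the subset transitive.
  refine ⟨sep s (fun n => Ord n ∧ Sub n s), ⟨⟨isSet_sep, ?_⟩, ?_⟩, ?_, ?_⟩
  · intro n hn m hm
    obtain ⟨-, hn1, hn2⟩ := mem_sep.1 hn
    exact mem_sep.2 ⟨hn2 m hm, hn1.of_mem hm, fun k hk => hn2 k (hn1.1.2 m hm k hk)⟩
  · intro n hn
    exact (mem_sep.1 hn).2.1.1
  · exact mem_sep.2 ⟨he' ▸ hes, ord_empty, fun _ h => (not_mem_empty h).elim⟩
  · intro n hn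
    obtain ⟨hn0, hn1, hn2⟩ := mem_sep.1 hn
    refine mem_sep.2 ⟨hs' n hn0, hn1.succ, fun k hk => ?_⟩
    rcases mem_succ.1 hk with hk | rfl
    · exact hn2 k hk
    · exact hn0

theorem exists_transSet_mem (x : M) : ∃ t, IsTransSet t ∧ x ∈ᵤ t := by
  obtain ⟨o, ho⟩ := exists_isLimit (M := M)
  -- Stage `n` consists of the members of `x` and the members of members of earlier stages.
  let F : M → M := recF (fun _ s => union x (sUnion (sUnion s)))
  have hF : ∀ n, n ∈ᵤ o → F n = union x (sUnion (sUnion (img F n))) := fun n hn =>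
    recF_eq_of_mem ho.1.1 hn
  have hFd : DF (fun v : Unit → M => F (v ())) := by
    simp only [F]
    infer_instance
  refine ⟨union (sUnion (img F o)) (upair x x), ⟨isSet_union, ?_⟩, by simp⟩
  intro y hy z hz
  rw [mem_union] at hy ⊢
  left
  simp only [mem_sUnion, mem_img] at hy ⊢
  rcases hy with ⟨_, ⟨n, hn, rfl⟩, hy⟩ | hy
  · refine ⟨_, ⟨_, ho.2.2 n hn, rfl⟩, ?_⟩
    rw [hF _ (ho.2.2 n hn), mem_union]
    right
    simp only [mem_sUnion, mem_img]
    exact ⟨y, ⟨_, ⟨n, by simp, rfl⟩, hy⟩, hz⟩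
  · rw [mem_upair, or_self] at hy
    subst hy
    refine ⟨_, ⟨_, ho.2.1, rfl⟩, ?_⟩
    rw [hF _ ho.2.1, mem_union]
    exact Or.inl hz

theorem mem_induction (P : M → Prop) [hP : Dfn (fun v : Unit → M => P (v ()))]
    (h : ∀ x, (∀ y, y ∈ᵤ x → P y) → P x) (x : M) : P x := by
  by_contra hx
  have hP' := fun {α : Type} (f : (α → M) → M) [DF f] => Dfn.app₁ hP f
  obtain ⟨t, ht, hxt⟩ := exists_transSet_mem x
  obtain ⟨y, hy, hny, hmin⟩ := exists_minimal (fun z => ¬ P z) hxt hx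
  exact hny (h y fun z hz => not_not.1 (hmin z hz (ht.2 y hy z hz)))

theorem recF_eq (G : M → M → M) [hG : DF (fun v : Bool → M => G (v false) (v true))] (x : M) :
    recF G x = G x (img (fun u => recF G u) x) := by
  obtain ⟨t, ht, hxt⟩ := exists_transSet_mem x
  exact recF_eq_of_mem ht hxt

theorem Ord.trichotomy {x y : M} (hx : Ord x) (hy : Ord y) : x ∈ᵤ y ∨ x = y ∨ y ∈ᵤ x := by
  revert x y
  suffices h : ∀ x : M, Ord x → ∀ y : M, Ord y → x ∈ᵤ y ∨ x = y ∨ y ∈ᵤ x from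
    fun {x y} hx hy => h x hx y hy
  refine mem_induction _ fun x ihx hx => ?_
  refine mem_induction _ fun y ihy hy => ?_
  by_cases h1 : ∃ a, a ∈ᵤ x ∧ (a = y ∨ y ∈ᵤ a)
  · obtain ⟨a, ha, rfl | h⟩ := h1
    · exact Or.inr (Or.inr ha)
    · exact Or.inr (Or.inr (hx.1.2 a ha y h))
  by_cases h2 : ∃ b, b ∈ᵤ y ∧ (x ∈ᵤ b ∨ x = b)
  · obtain ⟨b, hb, h | rfl⟩ := h2
    · exact Or.inl (hy.1.2 b hb x h)
    · exact Or.inl hb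
  refine Or.inr (Or.inl (set_ext hx.1.1 hy.1.1 fun z => ⟨fun hz => ?_, fun hz => ?_⟩))
  · rcases ihx z hz (hx.of_mem hz) y hy with h | h | h
    · exact h
    · exact absurd ⟨z, hz, Or.inl h⟩ h1
    · exact absurd ⟨z, hz, Or.inr h⟩ h1
  · rcases ihy z hz (hy.of_mem hz) with h | h | h
    · exact absurd ⟨z, hz, Or.inl h⟩ h2
    · exact absurd ⟨z, hz, Or.inr h⟩ h2
    · exact h

/-- The least ordinal with the property `P`. -/
noncomputable def lst (P : M → Prop) : M :=
  the (fun b => Ord b ∧ P b ∧ ∀ c, c ∈ᵤ b → ¬ P c)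

instance DF.lst (P : (α → M) → M → Prop)
    [hP : Dfn (fun w : α ⊕ Unit → M => P (pl w) (Urelement.top w))] :
    DF (fun v => lst (fun z => P v z)) := by
  unfold Urelement.lst
  have h1 : Dfn (fun w : (α ⊕ Unit) ⊕ Unit → M => P (pl (pl w)) (Urelement.top w)) :=
    hP.rename (Sum.map Sum.inl id)
  infer_instance

theorem lst_spec (P : M → Prop) [hP : Dfn (fun v : Unit → M => P (v ()))] {b : M} (hb : Ord b)
    (h : P b) : Ord (lst P) ∧ P (lst P) := by
  obtain ⟨c, hc, ⟨hc1, hc2⟩, hmin⟩ := exists_minimal P (t := succ b) (by simp) h |>.imp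
    (fun c hc => (⟨hc.1, ⟨hb.succ.of_mem hc.1, hc.2.1⟩,
      fun z hz => hc.2.2 z hz (hb.succ.1.2 c hc.1 z hz)⟩ :
      c ∈ᵤ succ b ∧ (Ord c ∧ P c) ∧ ∀ z, z ∈ᵤ c → ¬ P z))
  have : lst P = c := by
    refine the_eq ⟨hc1, hc2, hmin⟩ fun d ⟨hd1, hd2, hd3⟩ => ?_
    rcases hd1.trichotomy hc1 with h | h | h
    · exact absurd hd2 (hmin d h)
    · exact h
    · exact absurd hc2 (hd3 c h)
  rw [this]
  exact ⟨hc1, hc2⟩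

/-- A relation to ordinals that is definable and persists to larger ordinals is bounded on every
set. -/
theorem exists_ord_bound (R : M → M → Prop)
    [hR : Dfn (fun v : Bool → M => R (v false) (v true))]
    (hmono : ∀ x b c, Ord b → Ord c → Sub b c → R x b → R x c) (X : M)
    (h : ∀ x, x ∈ᵤ X → ∃ b, Ord b ∧ R x b) : ∃ b, Ord b ∧ ∀ x, x ∈ᵤ X → R x b := by
  have hR' := fun {α : Type} (f g : (α → M) → M) [DF f] [DF g] => Dfn.app₂ hR f g
  -- Choosing least ordinals turns the relation into a definable function, so Replacement applies;
  -- the bound is the supremum.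
  have hl : ∀ x, x ∈ᵤ X → Ord (lst (R x)) ∧ R x (lst (R x)) := fun x hx => by
    obtain ⟨b, hb, hxb⟩ := h x hx
    exact lst_spec (R x) hb hxb
  have ho : Ord (sUnion (img (fun x => lst (fun b => R x b)) X)) := by
    refine ord_sUnion fun y hy => ?_
    obtain ⟨x, hx, rfl⟩ := mem_img.1 hy
    exact (hl x hx).1
  refine ⟨_, ho, fun x hx => hmono x _ _ (hl x hx).1 ho (fun z hz => ?_) (hl x hx).2⟩
  exact mem_sUnion.2 ⟨_, mem_img.2 ⟨x, hx, rfl⟩, hz⟩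

/-- Simultaneous version of `exists_ord_bound` for finite tuples from a set. -/
theorem exists_ord_bound_tuple {k : ℕ} (R : (Fin k → M) → M → Prop)
    [hR : Dfn (fun w : Fin k ⊕ Unit → M => R (pl w) (top w))]
    (hmono : ∀ x b c, Ord b → Ord c → Sub b c → R x b → R x c) (X : M)
    (h : ∀ x : Fin k → M, (∀ i, x i ∈ᵤ X) → ∃ b, Ord b ∧ R x b) :
    ∃ b, Ord b ∧ ∀ x : Fin k → M, (∀ i, x i ∈ᵤ X) → R x b := by
  induction k with
  | zero =>
    obtain ⟨b, hb, hx⟩ := h Fin.elim0 (fun i => i.elim0)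
    refine ⟨b, hb, fun x _ => ?_⟩
    rwa [Subsingleton.elim x Fin.elim0]
  | succ k ih =>
    have hd : Dfn (fun w : (Fin k ⊕ Unit) ⊕ Unit → M =>
        R (Fin.cons (top w) (pl (pl w))) (top (pl w))) := by
      have h1 := hR.rename (α := (Fin k ⊕ Unit) ⊕ Unit)
        (Sum.elim (Fin.cons (Sum.inr ()) (fun i => Sum.inl (Sum.inl i))) (fun _ => Sum.inl (Sum.inr ())))
      refine h1.congr fun w => ?_
      rw [iff_iff_eq]
      congr 1
      funext i
      refine Fin.cases ?_ (fun i => ?_) i <;> rfl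
    have hd1 (x : Fin k → M) : Dfn (fun v : Bool → M => R (Fin.cons (v false) x) (v true)) := by
      have := hd.subst (α := Bool) (Sum.elim (Sum.elim (fun i _ => x i) (fun _ v => v true))
        (fun _ v => v false)) (by rintro ((i | i) | i) <;> simp <;> infer_instance)
      exact this
    -- For each tail the first coordinate is bounded uniformly; the induction hypothesis then bounds
    -- over the tails.
    obtain ⟨b, hb, h1⟩ := ih (fun x b => ∀ y, y ∈ᵤ X → R (Fin.cons y x) b)
      (fun x b c hb hc hbc h y hy => hmono _ b c hb hc hbc (h y hy))
      (fun x hx => exists_ord_bound (fun y b => R (Fin.cons y x) b)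
        (fun y b c hb hc hbc h => hmono _ b c hb hc hbc h) X
        fun y hy => h _ (Fin.cases hy hx))
    refine ⟨b, hb, fun x hx => ?_⟩
    rw [← Fin.cons_self_tail x]
    exact h1 _ (fun i => hx _) _ (hx 0)

end Recursion

/-! ### Definable automorphisms induced by moving urelements. -/

section Automorphisms

variable {M : Type*} [LU.Structure M] {α β γ : Type}

/-- An automorphism of `M` whose graph and inverse graph are definable with parameters. -/
structure DefAut (M : Type*) [LU.Structure M] extends M ≃ M where
  mem_iff' : ∀ x y, toFun x ∈ᵤ toFun y ↔ x ∈ᵤ y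
  isUr_iff' : ∀ x, IsUr (toFun x) ↔ IsUr x
  definable : DF (fun v : Unit → M => toFun (v ()))
  definable_symm : DF (fun v : Unit → M => invFun (v ()))

namespace DefAut

instance : CoeFun (DefAut M) (fun _ => M → M) := ⟨fun e => e.toEquiv⟩

variable (e : DefAut M)

@[simp] theorem mem_iff {x y : M} : e x ∈ᵤ e y ↔ x ∈ᵤ y := e.mem_iff' x y

@[simp] theorem isUr_iff {x : M} : IsUr (e x) ↔ IsUr x := e.isUr_iff' x

instance df (f : (α → M) → M) [DF f] : DF (fun v => e (f v)) := DF.app₁ e.definable f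

/-- The inverse of a definable automorphism. -/
def symm : DefAut M where
  toEquiv := e.toEquiv.symm
  mem_iff' x y := by
    have := e.mem_iff (x := e.toEquiv.symm x) (y := e.toEquiv.symm y)
    simpa using this.symm
  isUr_iff' x := by
    have := e.isUr_iff (x := e.toEquiv.symm x)
    simpa using this.symm
  definable := e.definable_symm
  definable_symm := e.definable

@[simp] theorem symm_apply_apply (x : M) : e.symm (e x) = x := e.toEquiv.symm_apply_apply x

@[simp] theorem apply_symm_apply (x : M) : e (e.symm x) = x := e.toEquiv.apply_symm_apply x

theorem injective {x y : M} (h : e x = e y) : x = y := e.toEquiv.injective h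

/-- The composition of two definable automorphisms. -/
def trans (e e' : DefAut M) : DefAut M where
  toEquiv := e.toEquiv.trans e'.toEquiv
  mem_iff' x y := by
    change e' (e x) ∈ᵤ e' (e y) ↔ _
    simp
  isUr_iff' x := by
    change IsUr (e' (e x)) ↔ _
    simp
  definable := by
    change DF (fun v : Unit → M => e' (e (v ())))
    infer_instance
  definable_symm := by
    change DF (fun v : Unit → M => e.symm (e'.symm (v ())))
    infer_instance

@[simp] theorem trans_apply (e e' : DefAut M) (x : M) : e.trans e' x = e' (e x) := rfl

theorem mem_apply_iff {x y : M} : x ∈ᵤ e y ↔ e.symm x ∈ᵤ y := by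
  rw [← e.mem_iff (x := e.symm x), e.apply_symm_apply]

/-- A definable automorphism as an isomorphism of first-order structures. -/
def toLEquiv : M ≃[LU] M where
  toEquiv := e.toEquiv
  map_fun' f := f.elim
  map_rel' R x := by
    cases R with
    | mem =>
      have h : x = ![x 0, x 1] := by funext i; fin_cases i <;> rfl
      have h' : e ∘ x = ![e (x 0), e (x 1)] := by funext i; fin_cases i <;> rfl
      change Structure.RelMap (L := LU) URel.mem (e ∘ x) ↔ _
      rw [h', h]
      exact e.mem_iff
    | ur =>
      have h : x = ![x 0] := by funext i; fin_cases i; rfl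
      have h' : e ∘ x = ![e (x 0)] := by funext i; fin_cases i; rfl
      change Structure.RelMap (L := LU) URel.ur (e ∘ x) ↔ _
      rw [h', h]
      exact e.isUr_iff

theorem realize_iff {n k : ℕ} (φ : LU.BoundedFormula (Fin n) k) (v : Fin n → M) (xs : Fin k → M) :
    φ.Realize (fun i => e (v i)) (fun i => e (xs i)) ↔ φ.Realize v xs :=
  StrongHomClass.realize_boundedFormula e.toLEquiv φ

end DefAut

variable [ZFUModel M]

section
variable (s : M → M)

/-- The extension to all objects of a function `s` on urelements. -/
noncomputable def extend (x : M) : M :=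
  recF (fun x t => the (fun y => (IsUr x ∧ y = s x) ∨ (¬ IsUr x ∧ y = t))) x

variable [hs : DF (fun v : Unit → M => s (v ()))]

theorem extend_aux (x : M) :
    extend s x = the (fun y => (IsUr x ∧ y = s x) ∨ (¬ IsUr x ∧ y = img (extend s) x)) := by
  have hs' := fun {α : Type} (f : (α → M) → M) [DF f] => DF.app₁ hs f
  exact recF_eq (fun x t => the (fun y => (IsUr x ∧ y = s x) ∨ (¬ IsUr x ∧ y = t))) x

theorem extend_of_isUr {x : M} (h : IsUr x) : extend s x = s x := by
  rw [extend_aux]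
  exact the_eq (Or.inl ⟨h, rfl⟩) fun y hy => by simpa [h] using hy

theorem extend_of_isSet {x : M} (h : IsSet x) : extend s x = img (extend s) x := by
  rw [extend_aux]
  rw [IsSet] at h
  exact the_eq (Or.inr ⟨h, rfl⟩) fun y hy => by simpa [h] using hy

theorem df_extend : DF (fun v : Unit → M => extend s (v ())) := by
  have hs' := fun {α : Type} (f : (α → M) → M) [DF f] => DF.app₁ hs f
  unfold extend
  infer_instance

/-- The automorphism induced by a definable involution of the class of urelements. -/
theorem exists_defAut_of_involution (hinv : ∀ a, IsUr a → s (s a) = a)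
    (hur : ∀ a, IsUr a → IsUr (s a)) : ∃ e : DefAut M, ∀ a, IsUr a → e a = s a := by
  have hd := df_extend s
  have hd' := fun {α : Type} (f : (α → M) → M) [DF f] => DF.app₁ hd f
  have hset : ∀ x, IsSet x → IsSet (extend s x) := fun x hx => by
    rw [extend_of_isSet s hx]; exact isSet_img
  have hU : ∀ x, IsUr (extend s x) ↔ IsUr x := fun x =>
    ⟨fun h => by_contra fun hx => hset x hx h, fun h => by
      rw [extend_of_isUr s h]; exact hur x h⟩
  -- Being its own inverse, the extension has a definable inverse and reflects membership as soon as
  -- it preserves it.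
  have hI : ∀ x, extend s (extend s x) = x := by
    refine mem_induction _ fun x ih => ?_
    by_cases hx : IsUr x
    · rw [extend_of_isUr s ((hU x).2 hx), extend_of_isUr s hx, hinv x hx]
    · have h2 := hset x hx
      rw [extend_of_isSet s h2]
      refine set_ext isSet_img hx fun z => ?_
      rw [extend_of_isSet s hx]
      simp only [mem_img]
      constructor
      · rintro ⟨_, ⟨w, hw, rfl⟩, rfl⟩
        rwa [ih w hw]
      · exact fun hz => ⟨_, ⟨z, hz, rfl⟩, (ih z hz).symm⟩
  have hmem : ∀ x y, x ∈ᵤ y → extend s x ∈ᵤ extend s y := fun x y h => by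
    rw [extend_of_isSet s (isSet_of_mem h)]
    exact mem_img.2 ⟨x, h, rfl⟩
  refine ⟨⟨⟨extend s, extend s, hI, hI⟩, fun x y => ⟨fun h => ?_, hmem x y⟩, hU, hd, hd⟩,
    fun a ha => extend_of_isUr s ha⟩
  have := hmem (extend s x) (extend s y) h
  rwa [hI, hI] at this
end

/-- Interchanging a set of urelements with a disjoint copy of it. -/
theorem exists_swap (F : M → M) [hF : DF (fun v : Unit → M => F (v ()))] (B : M)
    (hB : ∀ b, b ∈ᵤ B → IsUr b ∧ IsUr (F b) ∧ ¬ F b ∈ᵤ B)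
    (hinj : ∀ b c, b ∈ᵤ B → c ∈ᵤ B → F b = F c → b = c) :
    ∃ e : DefAut M, (∀ b, b ∈ᵤ B → e b = F b) ∧
      ∀ a, IsUr a → ¬ a ∈ᵤ B → (∀ b, b ∈ᵤ B → F b ≠ a) → e a = a := by
  have hF' := fun {α : Type} (f : (α → M) → M) [DF f] => DF.app₁ hF f
  -- Sends `B` to its copy by `F`, the copy back to `B`, and fixes everything else.
  let s : M → M := fun a => the (fun y => (a ∈ᵤ B ∧ y = F a) ∨
    (¬ a ∈ᵤ B ∧ ∃ b, b ∈ᵤ B ∧ F b = a ∧ y = b) ∨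
    (¬ a ∈ᵤ B ∧ (¬ ∃ b, b ∈ᵤ B ∧ F b = a) ∧ y = a))
  have hs : DF (fun v : Unit → M => s (v ())) := by
    simp only [s]
    infer_instance
  have s1 : ∀ a, a ∈ᵤ B → s a = F a := fun a ha =>
    the_eq (Or.inl ⟨ha, rfl⟩) fun y hy => by simpa [ha] using hy
  have s2 : ∀ b, b ∈ᵤ B → s (F b) = b := fun b hb => by
    have hn := (hB b hb).2.2
    refine the_eq (Or.inr (Or.inl ⟨hn, b, hb, rfl, rfl⟩)) fun y hy => ?_
    rcases hy with ⟨h, -⟩ | ⟨-, c, hc, he, rfl⟩ | ⟨-, h, -⟩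
    · exact absurd h hn
    · exact hinj _ _ hc hb he
    · exact absurd ⟨b, hb, rfl⟩ h
  have s3 : ∀ a, ¬ a ∈ᵤ B → (¬ ∃ b, b ∈ᵤ B ∧ F b = a) → s a = a := fun a h1 h2 => by
    refine the_eq (Or.inr (Or.inr ⟨h1, h2, rfl⟩)) fun y hy => ?_
    rcases hy with ⟨h, -⟩ | ⟨-, c, hc, he, -⟩ | ⟨-, -, h⟩
    · exact absurd h h1
    · exact absurd ⟨c, hc, he⟩ h2
    · exact h
  obtain ⟨e, he⟩ := exists_defAut_of_involution s (fun a ha => by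
      by_cases h1 : a ∈ᵤ B
      · rw [s1 a h1, s2 a h1]
      · by_cases h2 : ∃ b, b ∈ᵤ B ∧ F b = a
        · obtain ⟨b, hb, rfl⟩ := h2
          rw [s2 b hb, s1 b hb]
        · rw [s3 a h1 h2, s3 a h1 h2])
    (fun a ha => by
      by_cases h1 : a ∈ᵤ B
      · rw [s1 a h1]; exact (hB a h1).2.1
      · by_cases h2 : ∃ b, b ∈ᵤ B ∧ F b = a
        · obtain ⟨b, hb, rfl⟩ := h2
          rw [s2 b hb]; exact (hB b hb).1
        · rwa [s3 a h1 h2])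
  refine ⟨e, fun b hb => by rw [he b (hB b hb).1, s1 b hb], fun a ha h1 h2 => ?_⟩
  rw [he a ha, s3 a h1 fun ⟨b, hb, hab⟩ => h2 b hb hab]

/-- Every set is equinumerous with a set of urelements outside a given set. -/
theorem PlenitudePlus.exists_fresh (hP : PlenitudePlus M) (X K : M) :
    ∃ f : M, (∀ x, x ∈ᵤ X → IsUr (app f x) ∧ ¬ app f x ∈ᵤ K) ∧
      ∀ x y, x ∈ᵤ X → y ∈ᵤ X → app f x = app f y → x = y := by
  -- This provides disjoint copies of `X`, one for each subset of `K`; by Cantor's theorem they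
  -- cannot all meet `K`.
  obtain ⟨A, -, hA, h, ⟨hf, hinj⟩, -⟩ := hP (prod X (pow K)) isSet_prod
  have hval : ∀ x c, x ∈ᵤ X → c ∈ᵤ pow K → IsUr (app h (opair x c)) := fun x c hx hc =>
    hA _ (hf.app_mem (opair_mem_prod.2 ⟨hx, hc⟩))
  have hi : ∀ x c y d, x ∈ᵤ X → c ∈ᵤ pow K → y ∈ᵤ X → d ∈ᵤ pow K →
      app h (opair x c) = app h (opair y d) → x = y ∧ c = d := by
    intro x c y d hx hc hy hd he
    have h1 := hf.pairMem (opair_mem_prod.2 ⟨hx, hc⟩)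
    have h2 := hf.pairMem (opair_mem_prod.2 ⟨hy, hd⟩)
    rw [← he] at h2
    exact opair_inj.1 (hinj _ _ _ h1 h2)
  obtain ⟨c, hc, hcK⟩ : ∃ c, c ∈ᵤ pow K ∧ ∀ x, x ∈ᵤ X → ¬ app h (opair x c) ∈ᵤ K := by
    by_contra! hne
    -- Diagonal set: an element of `K` in some copy determines the index `c` of that copy, so the
    -- copy indexed by `D` cannot meet `K`.
    let D := sep K (fun k => ∃ x c, x ∈ᵤ X ∧ c ∈ᵤ pow K ∧ app h (opair x c) = k ∧ ¬ k ∈ᵤ c)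
    have hD : D ∈ᵤ pow K := mem_pow.2 ⟨isSet_sep, fun z hz => (mem_sep.1 hz).1⟩
    obtain ⟨x, hx, hk⟩ := hne D hD
    by_cases hkD : app h (opair x D) ∈ᵤ D
    · obtain ⟨y, c, hy, hc, he, hn⟩ := (mem_sep.1 hkD).2
      obtain ⟨-, rfl⟩ := hi _ _ _ _ hy hc hx hD he
      exact hn hkD
    · exact hkD (mem_sep.2 ⟨hk, x, D, hx, hD, rfl, hkD⟩)
  refine ⟨graph (fun x => app h (opair x c)) X, fun x hx => ?_, fun x y hx hy he => ?_⟩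
  · rw [app_graph hx]
    exact ⟨hval x c hx hc, hcK x hx⟩
  · rw [app_graph hx, app_graph hy] at he
    exact (hi _ _ _ _ hx hc hy hc he).1

/-- A definable injection between sets of urelements disjoint from `C` extends to a definable
automorphism that fixes the urelements in `C`. -/
theorem PlenitudePlus.exists_move (hP : PlenitudePlus M) (F : M → M)
    [hF : DF (fun v : Unit → M => F (v ()))] (B C : M)
    (hB : ∀ b, b ∈ᵤ B → IsUr b ∧ ¬ b ∈ᵤ C ∧ IsUr (F b) ∧ ¬ F b ∈ᵤ C)
    (hinj : ∀ b c, b ∈ᵤ B → c ∈ᵤ B → F b = F c → b = c) :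
    ∃ e : DefAut M, (∀ b, b ∈ᵤ B → e b = F b) ∧ ∀ c, c ∈ᵤ C → IsUr c → e c = c := by
  have hF' := fun {α : Type} (f : (α → M) → M) [DF f] => DF.app₁ hF f
  -- `B` and its image may overlap, so no single swap need do. A fresh copy disjoint from both and
  -- from `C` serves as an intermediate stop between two swaps.
  obtain ⟨g, hg, hgi⟩ := hP.exists_fresh B (union B (union (img F B) C))
  have hgB : ∀ b, b ∈ᵤ B → ¬ app g b ∈ᵤ B := fun b hb h =>
    (hg b hb).2 (by simp [h])
  have hgF : ∀ b c, b ∈ᵤ B → c ∈ᵤ B → app g b ≠ F c := fun b c hb hc h =>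
    (hg b hb).2 (by simp only [mem_union, mem_img]; exact Or.inr (Or.inl ⟨c, hc, h⟩))
  have hgC : ∀ b, b ∈ᵤ B → ¬ app g b ∈ᵤ C := fun b hb h =>
    (hg b hb).2 (by simp [h])
  obtain ⟨e₁, he₁, hf₁⟩ := exists_swap (fun b => app g b) B
    (fun b hb => ⟨(hB b hb).1, (hg b hb).1, hgB b hb⟩) hgi
  have hsymm : ∀ b, b ∈ᵤ B → e₁.symm (app g b) = b := fun b hb => by
    rw [← he₁ b hb, e₁.symm_apply_apply]
  obtain ⟨e₂, he₂, hf₂⟩ := exists_swap (fun y => F (e₁.symm y)) (img (fun b => app g b) B)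
    (by
      intro y hy
      obtain ⟨b, hb, rfl⟩ := mem_img.1 hy
      rw [hsymm b hb]
      refine ⟨(hg b hb).1, (hB b hb).2.2.1, fun h => ?_⟩
      obtain ⟨c, hc, h⟩ := mem_img.1 h
      exact hgF c b hc hb h.symm)
    (by
      intro y z hy hz h
      obtain ⟨b, hb, rfl⟩ := mem_img.1 hy
      obtain ⟨c, hc, rfl⟩ := mem_img.1 hz
      rw [hsymm b hb, hsymm c hc] at h
      rw [hinj b c hb hc h])
  refine ⟨e₁.trans e₂, fun b hb => ?_, fun c hc hu => ?_⟩
  · rw [DefAut.trans_apply, he₁ b hb, he₂ _ (mem_img.2 ⟨b, hb, rfl⟩), hsymm b hb]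
  · have h1 : e₁ c = c := hf₁ c hu (fun h => (hB c h).2.1 hc) fun b hb h =>
      hgC b hb (h ▸ hc)
    rw [DefAut.trans_apply, h1]
    refine hf₂ c hu (fun h => ?_) fun y hy h => ?_
    · obtain ⟨b, hb, rfl⟩ := mem_img.1 h
      exact hgC b hb hc
    · obtain ⟨b, hb, rfl⟩ := mem_img.1 hy
      rw [hsymm b hb] at h
      exact (hB b hb).2.2.2 (h ▸ hc)

end Automorphisms

/-! ### Levels over a set of urelements, the injective form of SVC, and closed limits. -/

section Hierarchy

variable {M : Type*} [LU.Structure M] {α β γ : Type}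

theorem Dfn.app_ctx {P : (α → M) → M → Prop}
    (hP : Dfn (fun w : α ⊕ Unit → M => P (pl w) (Urelement.top w)))
    (g : (β → M) → (α → M)) [hg : VarSubst g] (f : (β → M) → M) [DF f] :
    Dfn (fun w => P (g w) (f w)) := by
  obtain ⟨σ, hσ⟩ := hg.out
  have h1 : Dfn (fun w : β ⊕ Unit → M => P (g (pl w)) (Urelement.top w)) := by
    refine (hP.rename (Sum.map σ id)).congr fun w => ?_
    rw [hσ]
    rfl
  have h2 : Dfn (fun w : β → M => ∃ x, x = f w ∧ P (g w) x) := inferInstance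
  exact h2.congr fun w => by simp

variable [ZFUModel M]

/-- The `a`-th level of the cumulative hierarchy over the set `A` of urelements. -/
noncomputable def level (A a : M) : M :=
  recF (fun _ s => union A (sUnion (img (fun z => pow z) s))) a

instance DF.level (f g : (α → M) → M) [DF f] [DF g] : DF (fun v => level (f v) (g v)) := by
  unfold Urelement.level; infer_instance

theorem level_eq (A a : M) :
    level A a = union A (sUnion (img (fun z => pow z) (img (fun b => level A b) a))) :=
  recF_eq (fun _ s => union A (sUnion (img (fun z => pow z) s))) a

theorem mem_level {A a z : M} :
    z ∈ᵤ level A a ↔ z ∈ᵤ A ∨ ∃ b, b ∈ᵤ a ∧ IsSet z ∧ Sub z (level A b) := by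
  rw [level_eq, mem_union, mem_sUnion]
  refine or_congr Iff.rfl ?_
  simp only [mem_img]
  constructor
  · rintro ⟨_, ⟨_, ⟨b, hb, rfl⟩, rfl⟩, h⟩
    exact ⟨b, hb, mem_pow.1 h⟩
  · rintro ⟨b, hb, h⟩
    exact ⟨_, ⟨_, ⟨b, hb, rfl⟩, rfl⟩, mem_pow.2 h⟩

theorem isSet_level {A a : M} : IsSet (level A a) := by
  rw [level_eq]; exact isSet_union

theorem level_mono_right {A a b : M} (h : Sub a b) : Sub (level A a) (level A b) := fun z hz => by
  rw [mem_level] at hz ⊢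
  exact hz.imp_right fun ⟨c, hc, hz⟩ => ⟨c, h c hc, hz⟩

theorem level_mono_left {A B : M} (h : Sub A B) : ∀ a, Sub (level A a) (level B a) := by
  refine mem_induction _ fun a ih z hz => ?_
  rw [mem_level] at hz ⊢
  exact hz.imp (h z) fun ⟨c, hc, hzs, hz⟩ => ⟨c, hc, hzs, fun w hw => ih c hc w (hz w hw)⟩

theorem isTransSet_level {A a : M} (hA : ∀ x, x ∈ᵤ A → IsUr x) (ha : Ord a) :
    IsTransSet (level A a) := by
  refine ⟨isSet_level, fun y hy z hz => ?_⟩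
  rcases mem_level.1 hy with h | ⟨b, hb, -, h⟩
  · exact absurd (hA y h) (isSet_of_mem hz)
  · exact level_mono_right (ha.sub_of_mem hb) z (h z hz)

theorem DefAut.level_map (e : DefAut M) {A B : M} (h : ∀ a, a ∈ᵤ A → e a ∈ᵤ B) :
    ∀ a x, x ∈ᵤ level A a → e x ∈ᵤ level B a := by
  refine mem_induction _ fun a ih x hx => ?_
  rw [mem_level] at hx ⊢
  refine hx.imp (h x) fun ⟨c, hc, hxs, hx⟩ => ⟨c, hc, fun hu => hxs (e.isUr_iff.1 hu), ?_⟩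
  intro w hw
  rw [e.mem_apply_iff] at hw
  have := ih c hc _ (hx _ hw)
  rwa [e.apply_symm_apply] at this

/-- By `∈`-induction, a set built from fixed urelements has only fixed members, so Extensionality
fixes it. -/
theorem DefAut.level_fix (e : DefAut M) {A : M} (h : ∀ a, a ∈ᵤ A → e a = a) :
    ∀ a x, x ∈ᵤ level A a → e x = x := by
  refine mem_induction _ fun a ih x hx => ?_
  rcases mem_level.1 hx with hx | ⟨c, hc, hxs, hx⟩
  · exact h x hx
  · refine set_ext (fun hu => hxs (e.isUr_iff.1 hu)) hxs fun w => ⟨fun hw => ?_, fun hw => ?_⟩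
    · rw [e.mem_apply_iff] at hw
      have := ih c hc _ (hx _ hw)
      rw [e.apply_symm_apply] at this
      rwa [this]
    · rw [← ih c hc w (hx w hw)]
      exact e.mem_iff.2 hw

/-- By `∈`-induction: the levels reached by the members of a set have a common bound, and the set
appears one level later. -/
theorem exists_mem_level {t A : M} (ht : IsTransSet t) (hA : ∀ a, a ∈ᵤ t → IsUr a → a ∈ᵤ A) :
    ∀ x, x ∈ᵤ t → ∃ a, Ord a ∧ x ∈ᵤ level A a := by
  refine mem_induction _ fun x ih hx => ?_
  by_cases hu : IsUr x
  · exact ⟨empty, ord_empty, mem_level.2 (Or.inl (hA x hx hu))⟩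
  · obtain ⟨b, hb, h⟩ := exists_ord_bound (fun y b => y ∈ᵤ level A b)
      (fun y b c _ _ hbc => level_mono_right hbc y) x (fun y hy => ih y hy (ht.2 x hx y hy))
    exact ⟨succ b, hb.succ, mem_level.2 (Or.inr ⟨b, by simp, hu, h⟩)⟩

/-- `f` is an internal injection of `X` into `Y`. -/
def InjVia (f X Y : M) : Prop :=
  (∀ x, x ∈ᵤ X → app f x ∈ᵤ Y) ∧ ∀ x y, x ∈ᵤ X → y ∈ᵤ X → app f x = app f y → x = y

instance Dfn.injVia (f g h : (α → M) → M) [DF f] [DF g] [DF h] :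
    Dfn (fun v => InjVia (f v) (g v) (h v)) := by
  unfold InjVia; infer_instance

theorem prod_mono {x y a b : M} (h : Sub x y) (h' : Sub a b) : Sub (prod x a) (prod y b) := by
  intro z hz
  obtain ⟨p, q, hp, hq, rfl⟩ := mem_prod.1 hz
  exact opair_mem_prod.2 ⟨h p hp, h' q hq⟩

/-- Under SVC, some set `T` is such that every set injects into `T × b` for some ordinal `b`. -/
theorem SVC.exists_injVia (h : SVC M) :
    ∃ T : M, ∀ x : M, IsSet x → ∃ b f, Ord b ∧ InjVia f x (prod T b) := by
  obtain ⟨S, -, hS⟩ := h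
  -- Without choice no single preimage can be selected, so `y` is coded by the least `c` occurring
  -- in a preimage together with the set of all `s` with `g(s, c) = y`.
  refine ⟨pow S, fun x hx => ?_⟩
  obtain ⟨b, p, hb, hp, g, hg, hsurj⟩ := hS x hx
  rw [isProd_iff] at hp
  subst hp
  let P : M → M → Prop := fun y c => c ∈ᵤ b ∧ ∃ s, s ∈ᵤ S ∧ app g (opair s c) = y
  have hP : ∀ y, y ∈ᵤ x → P y (lst (P y)) := by
    intro y hy
    obtain ⟨q, hq⟩ := hsurj y hy
    have hqm := (hg.mem_of_pairMem hq).1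
    obtain ⟨s, c, hs, hc, rfl⟩ := mem_prod.1 hqm
    have hd : Dfn (fun v : Unit → M => P y (v ())) := by
      simp only [P]
      infer_instance
    exact (lst_spec (P y) (hb.ord.of_mem hc) ⟨hc, s, hs, hg.app_eq hqm hq⟩).2
  let J : M → M := fun y => opair (sep S (fun s => app g (opair s (lst (P y))) = y)) (lst (P y))
  have hJ : DF (fun v : Unit → M => J (v ())) := by
    simp only [J, P]
    infer_instance
  refine ⟨b, graph J x, hb.ord, fun y hy => ?_, fun y z hy hz he => ?_⟩
  · rw [app_graph hy]
    refine opair_mem_prod.2 ⟨mem_pow.2 ⟨isSet_sep, fun w hw => (mem_sep.1 hw).1⟩, (hP y hy).1⟩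
  · rw [app_graph hy, app_graph hz, opair_inj] at he
    obtain ⟨he, hl⟩ := he
    obtain ⟨-, s, hs, hsy⟩ := hP y hy
    have h1 : s ∈ᵤ sep S (fun s => app g (opair s (lst (P y))) = y) := mem_sep.2 ⟨hs, hsy⟩
    rw [he, mem_sep] at h1
    rw [← hsy, ← h1.2, hl]

theorem Ord.exists_gt {x y : M} (hx : Ord x) (hy : Ord y) :
    ∃ z, (z = Urelement.succ x ∨ z = Urelement.succ y) ∧ x ∈ᵤ z ∧ y ∈ᵤ z := by
  rcases hx.trichotomy hy with h | rfl | h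
  · exact ⟨_, Or.inr rfl, by simp [h], by simp⟩
  · exact ⟨_, Or.inr rfl, by simp, by simp⟩
  · exact ⟨_, Or.inl rfl, by simp, by simp [h]⟩

theorem IsLimit.exists_gt {l x y : M} (hl : IsLimit l) (hx : x ∈ᵤ l) (hy : y ∈ᵤ l) :
    ∃ z, z ∈ᵤ l ∧ x ∈ᵤ z ∧ y ∈ᵤ z := by
  obtain ⟨z, hz, h⟩ := (hl.1.of_mem hx).exists_gt (hl.1.of_mem hy)
  refine ⟨z, ?_, h⟩
  rcases hz with rfl | rfl
  · exact hl.2.2 _ hx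
  · exact hl.2.2 _ hy

/-- Arbitrarily large limit ordinals are closed under a given total relation on the ordinals. -/
theorem exists_closed_limit (R : M → M → Prop)
    [hR : Dfn (fun v : Bool → M => R (v false) (v true))]
    (htot : ∀ a, Ord a → ∃ b, Ord b ∧ R a b) {a₀ : M} (ha₀ : Ord a₀) :
    ∃ l, IsLimit l ∧ a₀ ∈ᵤ l ∧ ∀ a, a ∈ᵤ l → ∃ b, b ∈ᵤ l ∧ R a b := by
  have hR' := fun {α : Type} (f g : (α → M) → M) [DF f] [DF g] => Dfn.app₂ hR f g
  -- `b` contains the successor of, and an `R`-value for, each element of `a`. Iterating the least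
  -- such `b` along a limit ordinal gives the required closure.
  let N : M → M → Prop := fun a b => ∀ c, c ∈ᵤ a → succ c ∈ᵤ b ∧ ∃ d, d ∈ᵤ b ∧ R c d
  let F : M → M := fun a => lst (N a)
  have hF : ∀ a, Ord a → Ord (F a) ∧ N a (F a) := by
    intro a ha
    obtain ⟨b, hb, h⟩ := exists_ord_bound (fun c b => succ c ∈ᵤ b ∧ ∃ d, d ∈ᵤ b ∧ R c d)
      (fun x b c _ _ hbc ⟨h1, d, h2, h3⟩ => ⟨hbc _ h1, d, hbc _ h2, h3⟩) a (fun c hc => by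
        obtain ⟨d, hd, hcd⟩ := htot c (ha.of_mem hc)
        obtain ⟨z, hz, h1, h2⟩ := (ha.of_mem hc).succ.exists_gt hd
        refine ⟨z, ?_, h1, d, h2, hcd⟩
        rcases hz with rfl | rfl
        · exact (ha.of_mem hc).succ.succ
        · exact hd.succ)
    have hd : Dfn (fun v : Unit → M => N a (v ())) := by
      simp only [N]
      infer_instance
    exact lst_spec (N a) hb h
  have hFd : DF (fun v : Unit → M => F (v ())) := by
    simp only [F, N]
    infer_instance
  have hFd' := fun {α : Type} (f : (α → M) → M) [DF f] => DF.app₁ hFd f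
  let G : M → M := recF (fun _ s => union (succ a₀) (sUnion (img F s)))
  have hG : ∀ n, G n = union (succ a₀) (sUnion (img F (img G n))) :=
    recF_eq (fun _ s => union (succ a₀) (sUnion (img F s)))
  have hGd : DF (fun v : Unit → M => G (v ())) := by
    simp only [G]
    infer_instance
  have hGd' := fun {α : Type} (f : (α → M) → M) [DF f] => DF.app₁ hGd f
  have hGm : ∀ n a, a ∈ᵤ G n ↔ a ∈ᵤ succ a₀ ∨ ∃ m, m ∈ᵤ n ∧ a ∈ᵤ F (G m) := by
    intro n a
    rw [hG, mem_union, mem_sUnion]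
    refine or_congr Iff.rfl ?_
    simp only [mem_img]
    constructor
    · rintro ⟨_, ⟨_, ⟨m, hm, rfl⟩, rfl⟩, h⟩
      exact ⟨m, hm, h⟩
    · rintro ⟨m, hm, h⟩
      exact ⟨_, ⟨_, ⟨m, hm, rfl⟩, rfl⟩, h⟩
  have hGo : ∀ n, Ord (G n) := by
    refine mem_induction _ fun n ih => ?_
    rw [hG]
    refine ha₀.succ.union (ord_sUnion fun y hy => ?_)
    obtain ⟨z, hz, rfl⟩ := mem_img.1 hy
    obtain ⟨m, hm, rfl⟩ := mem_img.1 hz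
    exact (hF _ (ih m hm)).1
  obtain ⟨o, ho⟩ := exists_isLimit (M := M)
  -- Elements of the final stage already occur at an earlier one, whose closure under `N` is then
  -- used.
  have hstage : ∀ a, a ∈ᵤ G o → ∃ n, n ∈ᵤ o ∧ a ∈ᵤ G n := by
    intro a ha
    rcases (hGm _ _).1 ha with h | ⟨n, hn, h⟩
    · exact ⟨empty, ho.2.1, (hGm _ _).2 (Or.inl h)⟩
    · exact ⟨succ n, ho.2.2 n hn, (hGm _ _).2 (Or.inr ⟨n, by simp, h⟩)⟩
  refine ⟨G o, ⟨hGo o, ?_, fun a ha => ?_⟩, (hGm _ _).2 (Or.inl (by simp)), fun a ha => ?_⟩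
  · refine (hGm _ _).2 (Or.inl ?_)
    rcases (ord_empty (M := M)).trichotomy ha₀.succ with h | h | h
    · exact h
    · have : a₀ ∈ᵤ succ a₀ := by simp
      rw [← h] at this
      exact absurd this not_mem_empty
    · exact absurd h not_mem_empty
  · obtain ⟨n, hn, h⟩ := hstage a ha
    exact (hGm _ _).2 (Or.inr ⟨n, hn, ((hF _ (hGo n)).2 a h).1⟩)
  · obtain ⟨n, hn, h⟩ := hstage a ha
    obtain ⟨b, hb, hab⟩ := ((hF _ (hGo n)).2 a h).2
    exact ⟨b, (hGm _ _).2 (Or.inr ⟨n, hn, hb⟩), hab⟩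

end Hierarchy

/-! ### Configurations, bounded witnesses and the reflecting set. -/

section Reflection

variable {M : Type*} [LU.Structure M] {α β γ : Type} [ZFUModel M]

/-- The index set `T × (a × a)`. -/
noncomputable def index (T a : M) : M := prod T (prod a a)

instance DF.index (f g : (α → M) → M) [DF f] [DF g] : DF (fun v => index (f v) (g v)) := by
  unfold Urelement.index; infer_instance

theorem index_mono {T a b : M} (h : Sub a b) : Sub (index T a) (index T b) :=
  prod_mono (fun _ h => h) (prod_mono h h)

theorem mem_index {T a s x y : M} :
    opair s (opair x y) ∈ᵤ index T a ↔ s ∈ᵤ T ∧ x ∈ᵤ a ∧ y ∈ᵤ a := by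
  rw [index, opair_mem_prod, opair_mem_prod]

/-- `h` injects the index set of `a` into the urelements outside `K`. -/
def Config (K T h a : M) : Prop :=
  (∀ i, i ∈ᵤ index T a → IsUr (app h i) ∧ ¬ app h i ∈ᵤ K) ∧
    ∀ i j, i ∈ᵤ index T a → j ∈ᵤ index T a → app h i = app h j → i = j

instance Dfn.config (e f g h : (α → M) → M) [DF e] [DF f] [DF g] [DF h] :
    Dfn (fun v => Config (e v) (f v) (g v) (h v)) := by
  unfold Config; infer_instance

theorem Config.mono {K T h a b : M} (hc : Config K T h b) (hab : Sub a b) : Config K T h a :=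
  ⟨fun i hi => hc.1 i (index_mono hab i hi),
    fun i j hi hj => hc.2 i j (index_mono hab i hi) (index_mono hab j hj)⟩

/-- The urelements in `K` together with those enumerated by `h` on the index set of `a`. -/
noncomputable def base (K T h a : M) : M := union K (img (fun i => app h i) (index T a))

instance DF.base (e f g h : (α → M) → M) [DF e] [DF f] [DF g] [DF h] :
    DF (fun v => base (e v) (f v) (g v) (h v)) := by
  unfold Urelement.base; infer_instance

theorem mem_base {K T h a x : M} :
    x ∈ᵤ base K T h a ↔ x ∈ᵤ K ∨ ∃ i, i ∈ᵤ index T a ∧ x = app h i := by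
  rw [base, mem_union, mem_img]

theorem base_mono {K T h a b : M} (hab : Sub a b) : Sub (base K T h a) (base K T h b) := by
  intro x hx
  rw [mem_base] at hx ⊢
  exact hx.imp_right fun ⟨i, hi, e⟩ => ⟨i, index_mono hab i hi, e⟩

theorem Config.isUr_of_mem_base {K T h a x : M} (hK : ∀ x, x ∈ᵤ K → IsUr x)
    (hc : Config K T h a) (hx : x ∈ᵤ base K T h a) : IsUr x := by
  rcases mem_base.1 hx with hx | ⟨i, hi, rfl⟩
  · exact hK x hx
  · exact (hc.1 i hi).1

section Witness

variable {k : ℕ}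

/-- If `θ u` has a solution then it has one in level `b` over `A` and further urelements that
inject into `T × b`. -/
def Witness (θ : (Fin k → M) → M → Prop) (T : M) (u : Fin k → M) (A b : M) : Prop :=
  (∃ y, θ u y) → ∃ y j L, θ u y ∧ (∀ a, a ∈ᵤ L → IsUr a ∧ ¬ a ∈ᵤ A) ∧ InjVia j L (prod T b) ∧
    y ∈ᵤ level (union A L) b

theorem Witness.mono {θ : (Fin k → M) → M → Prop} {T : M} {u : Fin k → M} {A b c : M}
    (hbc : Sub b c) (h : Witness θ T u A b) : Witness θ T u A c := fun hy => by
  obtain ⟨y, j, L, h1, h2, h3, h4⟩ := h hy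
  exact ⟨y, j, L, h1, h2, ⟨fun x hx => prod_mono (fun _ h => h) hbc _ (h3.1 x hx), h3.2⟩,
    level_mono_right hbc _ h4⟩

/-- `b` bounds the witnesses for all tuples in level `a` over any configuration. -/
def Bounds (θ : (Fin k → M) → M → Prop) (K T a b : M) : Prop :=
  ∀ h, Config K T h a → ∀ u : Fin k → M, (∀ i, u i ∈ᵤ level (base K T h a) a) →
    Witness θ T u (base K T h a) b

variable (θ : (Fin k → M) → M → Prop)

instance Dfn.witness [hθ : Dfn (fun w : Fin k ⊕ Unit → M => θ (pl w) (Urelement.top w))]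
    (g : (α → M) → (Fin k → M)) [hg : VarSubst g] (e f h : (α → M) → M) [DF e] [DF f] [DF h] :
    Dfn (fun v => Witness θ (e v) (g v) (f v) (h v)) := by
  have := fun {β : Type} (g : (β → M) → (Fin k → M)) [VarSubst g] (f : (β → M) → M) [DF f] =>
    Dfn.app_ctx hθ g f
  have hcomp {β : Type} (f : (β → M) → (α → M)) [hf : VarSubst f] : VarSubst (fun w => g (f w)) := by
    obtain ⟨σ, hσ⟩ := hg.out
    obtain ⟨τ, hτ⟩ := hf.out
    exact ⟨τ ∘ σ, fun w => by rw [hσ, hτ]; rfl⟩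
  unfold Witness
  infer_instance

instance Dfn.bounds [hθ : Dfn (fun w : Fin k ⊕ Unit → M => θ (pl w) (Urelement.top w))]
    (e f g h : (α → M) → M) [DF e] [DF f] [DF g] [DF h] :
    Dfn (fun v => Bounds θ (e v) (f v) (g v) (h v)) := by
  unfold Bounds
  infer_instance

/-- A bound is found over one configuration `h₀`. An automorphism fixing `K` and sending each `h₀ i`
to `h i` transfers it to every other `h`; this uniformity allows the limit to be chosen before `h`.
-/
theorem exists_bounds (hP : PlenitudePlus M) {K T : M} (hK : ∀ x, x ∈ᵤ K → IsUr x)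
    (hT : ∀ x : M, IsSet x → ∃ b f, Ord b ∧ InjVia f x (prod T b))
    [hθ : Dfn (fun w : Fin k ⊕ Unit → M => θ (pl w) (top w))]
    (hinv : ∀ (e : DefAut M) u y, θ u y → θ (fun i => e (u i)) (e y))
    (a : M) : ∃ b, Ord b ∧ Bounds θ K T a b := by
  obtain ⟨h₀, hc₀⟩ : ∃ h, Config K T h a := hP.exists_fresh (index T a) K
  obtain ⟨b, hb, hw⟩ := exists_ord_bound_tuple
    (fun u b => Witness θ T u (base K T h₀ a) b) (fun u b c _ _ hbc => Witness.mono hbc)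
    (level (base K T h₀ a) a) (fun u _ => by
      by_cases hex : ∃ y, θ u y
      · obtain ⟨y, hy⟩ := hex
        obtain ⟨t, ht, hyt⟩ := exists_transSet_mem y
        -- The urelements on which the witness depends beyond the base.
        let L := sep t (fun x => IsUr x ∧ ¬ x ∈ᵤ base K T h₀ a)
        have hL : ∀ x, x ∈ᵤ L ↔ x ∈ᵤ t ∧ IsUr x ∧ ¬ x ∈ᵤ base K T h₀ a := fun x => mem_sep
        obtain ⟨c, j, hc, hj⟩ := hT L isSet_sep
        obtain ⟨d, hd, hyd⟩ := exists_mem_level (A := union (base K T h₀ a) L) ht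
          (fun x hx hu => by
            rw [mem_union, hL]
            by_cases hxb : x ∈ᵤ base K T h₀ a
            · exact Or.inl hxb
            · exact Or.inr ⟨hx, hu, hxb⟩) y hyt
        refine ⟨union c d, hc.union hd, fun _ => ⟨y, j, L, hy, fun x hx => ((hL x).1 hx).2,
          ⟨fun x hx => prod_mono (fun _ h => h) (fun z hz => ?_) _ (hj.1 x hx), hj.2⟩,
          level_mono_right (fun z hz => ?_) _ hyd⟩⟩
        · simp [hz]
        · simp [hz]
      · exact ⟨empty, ord_empty, fun h => absurd h hex⟩)
  refine ⟨b, hb, fun h hc u hu ⟨y, hy⟩ => ?_⟩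
  let F : M → M := fun x => app h (the (fun i => i ∈ᵤ index T a ∧ app h₀ i = x))
  have hF : ∀ i, i ∈ᵤ index T a → F (app h₀ i) = app h i := fun i hi => by
    simp only [F]
    congr 1
    exact the_eq ⟨hi, rfl⟩ fun j ⟨hj, he⟩ => hc₀.2 _ _ hj hi he
  have hFd : DF (fun v : Unit → M => F (v ())) := by
    simp only [F]
    infer_instance
  obtain ⟨e, he, hfix⟩ := hP.exists_move F (img (fun i => app h₀ i) (index T a)) K
    (fun x hx => by
      obtain ⟨i, hi, rfl⟩ := mem_img.1 hx
      rw [hF i hi]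
      exact ⟨(hc₀.1 i hi).1, (hc₀.1 i hi).2, hc.1 i hi⟩)
    (fun x y hx hy he => by
      obtain ⟨i, hi, rfl⟩ := mem_img.1 hx
      obtain ⟨j, hj, rfl⟩ := mem_img.1 hy
      rw [hF i hi, hF j hj] at he
      rw [hc.2 i j hi hj he])
  have heb : ∀ x, x ∈ᵤ base K T h₀ a → e x ∈ᵤ base K T h a := fun x hx => by
    rcases mem_base.1 hx with hx | ⟨i, hi, rfl⟩
    · rw [hfix x hx (hK x hx)]
      exact mem_base.2 (Or.inl hx)
    · rw [he _ (mem_img.2 ⟨i, hi, rfl⟩), hF i hi]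
      exact mem_base.2 (Or.inr ⟨i, hi, rfl⟩)
  have heb' : ∀ x, x ∈ᵤ base K T h a → e.symm x ∈ᵤ base K T h₀ a := fun x hx => by
    rcases mem_base.1 hx with hx | ⟨i, hi, rfl⟩
    · have : e.symm x = x := by
        conv_lhs => rw [← hfix x hx (hK x hx)]
        exact e.symm_apply_apply x
      rw [this]
      exact mem_base.2 (Or.inl hx)
    · rw [← hF i hi, ← he _ (mem_img.2 ⟨i, hi, rfl⟩), e.symm_apply_apply]
      exact mem_base.2 (Or.inr ⟨i, hi, rfl⟩)
  -- The tuple is pulled back to `h₀`, a bounded witness is found there, and it is carried forward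
  -- by `e` along with its urelements.
  obtain ⟨y', j, L, h1, h2, h3, h4⟩ := hw (fun i => e.symm (u i))
    (fun i => e.symm.level_map heb' a _ (hu i)) ⟨e.symm y, hinv e.symm u y hy⟩
  have hLe : ∀ x, x ∈ᵤ img (fun x => e x) L → e.symm x ∈ᵤ L := fun x hx => by
    obtain ⟨z, hz, rfl⟩ := mem_img.1 hx
    rwa [e.symm_apply_apply]
  refine ⟨e y', graph (fun x => app j (e.symm x)) (img (fun x => e x) L), img (fun x => e x) L,
    ?_, fun x hx => ?_, ⟨fun x hx => ?_, fun x z hx hz he => ?_⟩, e.level_map (fun x hx => ?_) b _ h4⟩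
  · have := hinv e _ _ h1
    simpa using this
  · obtain ⟨z, hz, rfl⟩ := mem_img.1 hx
    refine ⟨e.isUr_iff.2 (h2 z hz).1, fun h => (h2 z hz).2 ?_⟩
    rw [← e.symm_apply_apply z]
    exact heb' _ h
  · rw [app_graph hx]
    exact h3.1 _ (hLe x hx)
  · rw [app_graph hx, app_graph hz] at he
    exact e.symm.injective (h3.2 _ _ (hLe x hx) (hLe z hz) he)
  · rw [mem_union] at hx ⊢
    exact hx.imp (heb x) fun hx => mem_img.2 ⟨x, hx, rfl⟩

/-- In a configuration on a limit ordinal, bounded witnesses can be moved into the levels over the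
configuration. -/
theorem Bounds.exists_mem (hP : PlenitudePlus M) {K T : M} (hK : ∀ x, x ∈ᵤ K → IsUr x)
    (hinv : ∀ (e : DefAut M) u y, θ u y → θ (fun i => e (u i)) (e y))
    {l h a b : M} (hl : IsLimit l) (hc : Config K T h l) (ha : a ∈ᵤ l) (hb : b ∈ᵤ l)
    (hab : Bounds θ K T a b) {u : Fin k → M} (hu : ∀ i, u i ∈ᵤ level (base K T h a) a)
    (hex : ∃ y, θ u y) : ∃ y d, θ u y ∧ d ∈ᵤ l ∧ y ∈ᵤ level (base K T h d) d := by
  obtain ⟨d, hd, had, hbd⟩ := hl.exists_gt ha hb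
  have hdo := hl.1.of_mem hd
  have hca := hc.mono (hl.1.sub_of_mem ha)
  have hcd := hc.mono (hl.1.sub_of_mem hd)
  obtain ⟨y, j, L, h1, h2, h3, h4⟩ := hab h hca u hu hex
  -- With the tag `a` the index lies in `index T d`, since `a ∈ d`, but outside `index T a`, since
  -- `a ∉ a`.
  let I : M → M := fun x => the (fun i => ∃ s c, app j x = opair s c ∧ i = opair s (opair c a))
  have hI : ∀ x, x ∈ᵤ L → ∃ s c, app j x = opair s c ∧ s ∈ᵤ T ∧ c ∈ᵤ b ∧
      I x = opair s (opair c a) := by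
    intro x hx
    obtain ⟨s, c, hs, hc, he⟩ := mem_prod.1 (h3.1 x hx)
    refine ⟨s, c, he, hs, hc, the_eq ⟨s, c, he, rfl⟩ ?_⟩
    rintro i ⟨s', c', he', rfl⟩
    rw [he, opair_inj] at he'
    rw [he'.1, he'.2]
  have hId : ∀ x, x ∈ᵤ L → I x ∈ᵤ index T d := by
    intro x hx
    obtain ⟨s, c, -, hs, hc, he⟩ := hI x hx
    rw [he, mem_index]
    exact ⟨hs, hdo.1.2 b hbd c hc, had⟩
  have hIa : ∀ x, x ∈ᵤ L → ¬ I x ∈ᵤ index T a := by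
    intro x hx
    obtain ⟨s, c, -, hs, hc, he⟩ := hI x hx
    rw [he, mem_index]
    exact fun h => not_mem_self a h.2.2
  have hIinj : ∀ x z, x ∈ᵤ L → z ∈ᵤ L → I x = I z → x = z := by
    intro x z hx hz he
    obtain ⟨s, c, h5, -, -, h6⟩ := hI x hx
    obtain ⟨s', c', h7, -, -, h8⟩ := hI z hz
    rw [h6, h8, opair_inj, opair_inj] at he
    refine h3.2 x z hx hz ?_
    rw [h5, h7, he.1, he.2.1]
  have hdI : DF (fun v : Unit → M => app h (I (v ()))) := by
    simp only [I]
    infer_instance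
  -- Moves the new urelements onto unused values of `h` while fixing the base, and therefore every
  -- entry of `u`.
  obtain ⟨e, he, hfix⟩ := hP.exists_move (fun x => app h (I x)) L (base K T h a)
    (fun x hx => by
      refine ⟨(h2 x hx).1, (h2 x hx).2, (hcd.1 _ (hId x hx)).1, fun hm => ?_⟩
      rcases mem_base.1 hm with hm | ⟨i, hi, hm⟩
      · exact (hcd.1 _ (hId x hx)).2 hm
      · have := hcd.2 _ _ (hId x hx) (index_mono (hdo.sub_of_mem had) i hi) hm
        exact hIa x hx (this ▸ hi))
    (fun x z hx hz he => hIinj x z hx hz (hcd.2 _ _ (hId x hx) (hId z hz) he))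
  have hfix' : ∀ x, x ∈ᵤ base K T h a → e x = x := fun x hx =>
    hfix x hx (hca.isUr_of_mem_base hK hx)
  refine ⟨e y, d, ?_, hd, level_mono_right (hdo.sub_of_mem hbd) _
    (e.level_map (fun x hx => ?_) b y h4)⟩
  · have := hinv e u y h1
    rwa [show (fun i => e (u i)) = u from
      funext fun i => e.level_fix hfix' a (u i) (hu i)] at this
  · rcases mem_union.1 hx with hx | hx
    · rw [hfix' x hx]
      exact base_mono (hdo.sub_of_mem had) x hx
    · rw [he x hx]
      exact mem_base.2 (Or.inr ⟨_, hId x hx, rfl⟩)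

end Witness

/-- The union of the levels below the limit `l` over the configuration `h`. -/
noncomputable def reflSet (K T h l : M) : M :=
  sUnion (img (fun a => level (base K T h a) a) l)

theorem mem_reflSet {K T h l x : M} :
    x ∈ᵤ reflSet K T h l ↔ ∃ a, a ∈ᵤ l ∧ x ∈ᵤ level (base K T h a) a := by
  simp only [reflSet, mem_sUnion, mem_img]
  constructor
  · rintro ⟨_, ⟨a, ha, rfl⟩, h⟩; exact ⟨a, ha, h⟩
  · rintro ⟨a, ha, h⟩; exact ⟨_, ⟨a, ha, rfl⟩, h⟩

theorem isTransSet_reflSet {K T h l : M} (hK : ∀ x, x ∈ᵤ K → IsUr x) (hl : IsLimit l)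
    (hc : Config K T h l) : IsTransSet (reflSet K T h l) := by
  refine ⟨isSet_sUnion, fun y hy z hz => ?_⟩
  obtain ⟨a, ha, hya⟩ := mem_reflSet.1 hy
  have hca := hc.mono (hl.1.sub_of_mem ha)
  exact mem_reflSet.2 ⟨a, ha, (isTransSet_level (fun x hx => hca.isUr_of_mem_base hK hx)
    (hl.1.of_mem ha)).2 y hya z hz⟩

/-- Levels grow with the ordinal together with their bases, so finitely many elements fit into one.
-/
theorem IsLimit.exists_common_level {K T h l : M} (hl : IsLimit l) {k : ℕ} (u : Fin k → M)
    (hu : ∀ i, u i ∈ᵤ reflSet K T h l) :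
    ∃ a, a ∈ᵤ l ∧ ∀ i, u i ∈ᵤ level (base K T h a) a := by
  have hmono : ∀ a b, Sub a b → Sub (level (base K T h a) a) (level (base K T h b) b) :=
    fun a b hab x hx => level_mono_right hab x (level_mono_left (base_mono hab) a x hx)
  induction k with
  | zero => exact ⟨empty, hl.2.1, fun i => i.elim0⟩
  | succ k ih =>
    obtain ⟨a, ha, h1⟩ := ih (fun i => u i.succ) (fun i => hu _)
    obtain ⟨b, hb, h2⟩ := mem_reflSet.1 (hu 0)
    obtain ⟨d, hd, had, hbd⟩ := hl.exists_gt ha hb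
    have hdo := hl.1.of_mem hd
    exact ⟨d, hd, Fin.cases (hmono b d (hdo.sub_of_mem hbd) _ h2)
      fun i => hmono a d (hdo.sub_of_mem had) _ (h1 i)⟩

/-- Every formula is reflected by the limits closed under a suitable total definable relation
between ordinals. -/
theorem exists_reflecting_relation (hP : PlenitudePlus M) {K T : M} (hK : ∀ x, x ∈ᵤ K → IsUr x)
    (hT : ∀ x : M, IsSet x → ∃ b f, Ord b ∧ InjVia f x (prod T b)) {n k : ℕ}
    (φ : LU.BoundedFormula (Fin n) k) :
    ∃ R : M → M → Prop, Dfn (fun v : Bool → M => R (v false) (v true)) ∧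
      (∀ a b c, Sub b c → R a b → R a c) ∧ (∀ a, Ord a → ∃ b, Ord b ∧ R a b) ∧
      ∀ l h, IsLimit l → Config K T h l → (∀ a, a ∈ᵤ l → ∃ b, b ∈ᵤ l ∧ R a b) →
        ∀ (v : Fin n → M) (xs : Fin k → M), (∀ i, v i ∈ᵤ reflSet K T h l) →
          (∀ i, xs i ∈ᵤ reflSet K T h l) →
          (φ.Realize v xs ↔ RealizeIn (reflSet K T h l) φ v xs) := by
  have htriv : ∀ a : M, Ord a → ∃ b : M, Ord b ∧ True := fun a ha => ⟨a, ha, trivial⟩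
  induction φ with
  | falsum =>
    exact ⟨fun _ _ => True, inferInstance, fun _ _ _ _ _ => trivial, htriv,
      fun _ _ _ _ _ _ _ _ _ => Iff.rfl⟩
  | equal t₁ t₂ =>
    exact ⟨fun _ _ => True, inferInstance, fun _ _ _ _ _ => trivial, htriv,
      fun _ _ _ _ _ _ _ _ _ => Iff.rfl⟩
  | rel r ts =>
    exact ⟨fun _ _ => True, inferInstance, fun _ _ _ _ _ => trivial, htriv,
      fun _ _ _ _ _ _ _ _ _ => Iff.rfl⟩
  | imp φ ψ ih₁ ih₂ =>
    obtain ⟨R₁, d₁, m₁, t₁, r₁⟩ := ih₁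
    obtain ⟨R₂, d₂, m₂, t₂, r₂⟩ := ih₂
    refine ⟨fun a b => R₁ a b ∧ R₂ a b, inferInstance,
      fun a b c hbc h => ⟨m₁ a b c hbc h.1, m₂ a b c hbc h.2⟩, fun a ha => ?_, ?_⟩
    · obtain ⟨b, hb, h1⟩ := t₁ a ha
      obtain ⟨c, hc, h2⟩ := t₂ a ha
      exact ⟨union b c, hb.union hc, m₁ a b _ (fun z hz => by simp [hz]) h1,
        m₂ a c _ (fun z hz => by simp [hz]) h2⟩
    · intro l h hl hc hcl v xs hv hxs
      have e1 := r₁ l h hl hc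
        (fun a ha => (hcl a ha).imp fun b hb => ⟨hb.1, hb.2.1⟩) v xs hv hxs
      have e2 := r₂ l h hl hc
        (fun a ha => (hcl a ha).imp fun b hb => ⟨hb.1, hb.2.2⟩) v xs hv hxs
      exact imp_congr e1 e2
  | @all k ψ ih =>
    obtain ⟨R, d, m, t, r⟩ := ih
    -- Counterexamples to the universal formula, with the free and bound variables merged into one
    -- tuple.
    let θ : (Fin (n + k) → M) → M → Prop := fun u y =>
      ¬ ψ.Realize (fun i => u (Fin.castAdd k i))
        (Fin.snoc (α := fun _ => M) (fun i => u (Fin.natAdd n i)) y)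
    have hθ : Dfn (fun w : Fin (n + k) ⊕ Unit → M => θ (pl w) (top w)) := by
      have h1 : Dfn (fun w : Fin n ⊕ Fin (k + 1) → M => ψ.toFormula.Realize w) :=
        ⟨Set.Definable.mono (A := ∅) (Set.empty_definable_iff.2 ⟨ψ.toFormula, rfl⟩)
          (Set.empty_subset _)⟩
      have h2 := h1.rename (α := Fin (n + k) ⊕ Unit)
        (Sum.elim (fun i => Sum.inl (Fin.castAdd k i))
          (Fin.snoc (α := fun _ => Fin (n + k) ⊕ Unit) (fun i => Sum.inl (Fin.natAdd n i))
            (Sum.inr ())))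
      have h3 := Dfn.not _ (hP := h2)
      refine h3.congr fun w => ?_
      simp only [θ, BoundedFormula.realize_toFormula]
      rw [iff_iff_eq]
      congr 2
      funext i
      refine Fin.lastCases ?_ (fun i => ?_) i
      · simp [top]
      · simp [pl]
    -- All parameters of `ψ` are entries of `u` or `y`, so automorphisms preserve `θ`.
    have hinv : ∀ (e : DefAut M) u y, θ u y → θ (fun i => e (u i)) (e y) := by
      intro e u y h h'
      refine h ((e.realize_iff ψ _ _).1 ?_)
      convert h' using 1
      funext i
      refine Fin.lastCases ?_ (fun i => ?_) i <;> simp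
    refine ⟨fun a b => R a b ∧ Bounds θ K T a b, inferInstance,
      fun a b c hbc h => ⟨m a b c hbc h.1, fun h' hc u hu => (h.2 h' hc u hu).mono hbc⟩,
      fun a ha => ?_, ?_⟩
    · obtain ⟨b, hb, h1⟩ := t a ha
      obtain ⟨c, hc, h2⟩ := exists_bounds θ hP hK hT hinv a
      exact ⟨union b c, hb.union hc, m a b _ (fun z hz => by simp [hz]) h1,
        fun h' hc u hu => (h2 h' hc u hu).mono (fun z hz => by simp [hz])⟩
    · intro l h hl hc hcl v xs hv hxs
      have e := r l h hl hc (fun a ha => (hcl a ha).imp fun b hb => ⟨hb.1, hb.2.1⟩) v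
      have hsnoc : ∀ y, y ∈ᵤ reflSet K T h l →
          ∀ i, (Fin.snoc xs y : Fin (k + 1) → M) i ∈ᵤ reflSet K T h l := by
        intro y hy i
        refine Fin.lastCases ?_ (fun i => ?_) i
        · simpa using hy
        · simpa using hxs i
      rw [BoundedFormula.realize_all]
      change _ ↔ ∀ y, y ∈ᵤ reflSet K T h l → RealizeIn (reflSet K T h l) ψ v (Fin.snoc xs y)
      refine ⟨fun H y hy => (e _ hv (hsnoc y hy)).1 (H y), fun H => ?_⟩
      -- Tarski–Vaught step: a counterexample anywhere in `M` yields one inside the reflecting set.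
      by_contra hne
      obtain ⟨y₀, hy₀⟩ := not_forall.1 hne
      have hθu : ∀ y, θ (Fin.append v xs) y ↔ ¬ ψ.Realize v (Fin.snoc xs y) := fun y => by
        simp [θ]
      obtain ⟨a, ha, hu⟩ := hl.exists_common_level (K := K) (T := T) (h := h) (Fin.append v xs)
        (fun i => by
          refine Fin.addCases (fun i => ?_) (fun i => ?_) i
          · simpa using hv i
          · simpa using hxs i)
      obtain ⟨b, hb, -, hab⟩ := hcl a ha
      obtain ⟨y, d, hy, hd, hyd⟩ := hab.exists_mem θ hP hK hinv hl hc ha hb hu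
        ⟨y₀, (hθu y₀).2 hy₀⟩
      have hyt := mem_reflSet.2 ⟨d, hd, hyd⟩
      exact (hθu y).1 hy ((e _ hv (hsnoc y hyt)).2 (H y hyt))

theorem reflects (hS : SVC M) (hP : PlenitudePlus M) {n : ℕ} (φ : LU.Formula (Fin n)) :
    Reflects M φ := by
  intro x _
  obtain ⟨T, hT⟩ := hS.exists_injVia
  obtain ⟨t, ht, hxt⟩ := exists_transSet_mem x
  have hK : ∀ a, a ∈ᵤ sep t (fun a => IsUr a) → IsUr a := fun a ha => (mem_sep.1 ha).2
  obtain ⟨a, ha, hxa⟩ := exists_mem_level (A := sep t (fun a => IsUr a)) ht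
    (fun b hb hu => mem_sep.2 ⟨hb, hu⟩) x hxt
  obtain ⟨R, hR, -, htot, hrefl⟩ := exists_reflecting_relation hP hK hT φ
  obtain ⟨l, hl, hal, hcl⟩ := exists_closed_limit R htot ha
  -- The configuration is chosen only now, after `l`; the bounds defining `l` hold for every
  -- configuration.
  obtain ⟨h, hc⟩ : ∃ h, Config (sep t (fun a => IsUr a)) T h l :=
    hP.exists_fresh (index T l) (sep t (fun a => IsUr a))
  have htr := isTransSet_reflSet hK hl hc
  refine ⟨_, htr, htr.2 x (mem_reflSet.2 ⟨a, hal, ?_⟩), fun v hv => ?_⟩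
  · exact level_mono_left (fun z hz => mem_base.2 (Or.inl hz)) a x hxa
  · have := hrefl l h hl hc hcl v Fin.elim0 hv (fun i => i.elim0)
    rw [← this, Formula.Realize, Subsingleton.elim Fin.elim0 default]

end Reflection

end Urelement

theorem theorem3 {M : Type*} [Urelement.LU.Structure M] (hZFUR : Urelement.ZFUR M)
    (hSVC : Urelement.SVC M) (hPlen : Urelement.PlenitudePlus M) :
    Urelement.ReflectionPrinciple M := by
  have : Urelement.ZFUModel M := ⟨hZFUR⟩
  exact fun _ φ => Urelement.reflects hSVC hPlen φ
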